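/- Let $K$ be an algebraically closed field and $A=KQ/I$ a gentle algebra, where $Q$ is a finite connected quiver with vertex set $Q_0$, at least one arrow, and source and target maps $s,t$ (paths are written from left to right), and $I$ is generated by a set $R$ of paths of length two. Gentle means: every vertex has at most two incoming and at most two outgoing arrows; for every arrow $\alpha$ there is at most one arrow $\beta$ with $t(\beta)=s(\alpha)$ and $\beta\alpha\in I$, at most one with $t(\beta)=s(\alpha)$ and $\beta\alpha\notin I$, and dually for $\alpha\beta$ with $s(\beta)=t(\alpha)$ (these conditions are called locally gentle); and there is no oriented cycle $\alpha_1\cdots\alpha_n$, $n\ge 1$, with $\alpha_i\alpha_{i+1}\notin I$ for all $i$ modulo $n$. A path $\alpha_1\cdots\alpha_n$ ($n\ge1$) is a path in $A$ if it is not in $I$, and an antipath in $A$ if $\alpha_i\alpha_{i+1}\in I$ for all $1\le i<n$; it is maximal if it cannot be extended as such by an arrow on either side. All these notions depend only on $(Q,R)$. Blossoming. Let $(Q^{*},I^{*})$ be obtained by adding, at every $v\in Q_0$, $2-\deg^{\mathrm{in}}(v)$ arrows into $v$ from new pairwise distinct source vertices and $2-\deg^{\mathrm{out}}(v)$ arrows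 out of $v$ to new pairwise distinct sink vertices, and by adding relations of length two, so that $(Q^{*},I^{*})$ is locally gentle and a product of two arrows of $Q$ lies in $I^{*}$ if and only if it lies in $I$. Put $A^{*}=KQ^{*}/I^{*}$. Label the new sources $s_1,\dots,s_m$ and the new sinks $t_1,\dots,t_m$ so that $s_p$ and $t_p$ are connected by a maximal path in $A^{*}$, and let $\sigma_p,\tau_p$ be the new arrows with source $s_p$ and with target $t_p$, respectively. Invariants. For each $p$ there is a unique maximal antipath $\Delta_p$ in $A^{*}$ that ends at $t_p$; it starts at some $s_{\Phi(p)}$, and $\Phi$ is a permutation of $\{1,\dots,m\}$. Let $\delta_p$ be $\Delta_p$ without its first and last arrow, so that $\mathrm{length}(\delta_p)=\mathrm{length}(\Delta_p)-2$. For $q\ge 1$ and $l\ge 0$, $\phi_A(q,l)$ is the number of orbits $\mathcal O$ of $\Phi$ with $|\mathcal O|=q$ and $\sum_{p\in\mathcal O}\mathrm{length}(\delta_p)=l$; and $\phi_A(0,l)$ is the number of primitive anticycles of length $l$ in $A$, up to rotation. Repetition. For $k\ge 1$, the quiver $Q^{(k)}$ of the gentle algebra $A^{(k)}=KQ^{(k)}/I^{(k)}$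 consists of $k$ copies $Q^{[1]},\dots,Q^{[k]}$ of $Q$ and of connecting arrows $\varpi_p^{[i]}\colon s(\tau_p)^{[i]}\to t(\sigma_p)^{[i+1]}$ for $1\le p\le m$ and $1\le i<k$. The ideal $I^{(k)}$ is generated by the paths of length two of the following forms, where $\alpha,\beta$ are arrows of $Q$: $\alpha^{[i]}\beta^{[i]}$ with $\alpha\beta\in I$; $\alpha^{[i]}\varpi_p^{[i]}$ with $\alpha\tau_p\in I^{*}$; $\varpi_p^{[i]}\beta^{[i+1]}$ with $\sigma_p\beta\in I^{*}$; and $\varpi_p^{[i]}\varpi_{p'}^{[i+1]}$ with $\sigma_p\tau_{p'}\in I^{*}$. Then for all integers $q\ge 1$ and $l\ge 0$, with $d=\gcd(q,l)$, $$\phi_A(q,l)=\frac1q\sum_{c\mid d}\mu(c)\,\phi_{A^{(q/c)}}\Bigl(1,\frac{q+l}{c}-1\Bigr),$$ where the sum is over the positive divisors $c$ of $d$ and $\mu$ is the Möbius function. -/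

import Mathlib

universe u

/-- A bound quiver `(Q, I)` with `I` quadratic monomial: vertices `V`, arrows `E`, source and target
maps, and the set `R` of paths of length two that generates `I`. Paths are written from left to
right; `rel α β` says that the path `αβ` belongs to `R`, equivalently that `αβ ∈ I`. -/
structure BoundQuiver where
  V : Type u
  E : Type u
  s : E → V
  t : E → V
  rel : E → E → Prop
  rel_comp : ∀ α β, rel α β → t α = s β

/-- A nonempty word in which consecutive letters are `r`-related, and which can be extended by a
single letter neither on the left nor on the right. -/
structure IsMaximalWord {X : Type u} (r : X → X → Prop) (w : List X) : Prop where
  ne_nil : w ≠ []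
  chain : w.IsChain r
  left : ∀ x, ¬ (x :: w).IsChain r
  right : ∀ x, ¬ (w ++ [x]).IsChain r

namespace BoundQuiver

/-- `αβ` is a path of `Q` that does not lie in `I`. -/
def Permitted (A : BoundQuiver.{u}) (α β : A.E) : Prop := A.t α = A.s β ∧ ¬ A.rel α β

/-- Maximal paths in `A` (non-trivial permitted threads). A path lies in the ideal generated by
`R` exactly if two consecutive arrows of it form an element of `R`. -/
def IsMaxPath (A : BoundQuiver.{u}) (w : List A.E) : Prop := IsMaximalWord A.Permitted w

/-- Maximal antipaths in `A` (non-trivial forbidden threads). -/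
def IsMaxAntipath (A : BoundQuiver.{u}) (w : List A.E) : Prop := IsMaximalWord A.rel w

/-- Oriented cycles in `A`, up to rotation; they are primitive: no arrow is repeated. -/
def IsOrientedCycle (A : BoundQuiver.{u}) (c : Cycle A.E) : Prop :=
  c ≠ Cycle.nil ∧ c.Nodup ∧ c.Chain A.Permitted

/-- Anticycles in `A`, up to rotation; they are primitive: no arrow is repeated. -/
def IsAnticycle (A : BoundQuiver.{u}) (c : Cycle A.E) : Prop :=
  c ≠ Cycle.nil ∧ c.Nodup ∧ c.Chain A.rel

/-- The underlying undirected graph of `Q` is connected. -/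
def IsConnected (A : BoundQuiver.{u}) : Prop :=
  Nonempty A.V ∧ ∀ v w : A.V, Relation.EqvGen (fun a b => ∃ α, A.s α = a ∧ A.t α = b) v w

structure IsLocallyGentle (A : BoundQuiver.{u}) : Prop where
  in_le : ∀ v, {α | A.t α = v}.encard ≤ 2
  out_le : ∀ v, {α | A.s α = v}.encard ≤ 2
  rel_left : ∀ α, {β | A.t β = A.s α ∧ A.rel β α}.encard ≤ 1
  nrel_left : ∀ α, {β | A.t β = A.s α ∧ ¬ A.rel β α}.encard ≤ 1
  rel_right : ∀ α, {β | A.s β = A.t α ∧ A.rel α β}.encard ≤ 1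
  nrel_right : ∀ α, {β | A.s β = A.t α ∧ ¬ A.rel α β}.encard ≤ 1

structure IsGentle (A : BoundQuiver.{u}) : Prop extends A.IsLocallyGentle where
  no_cycle : ∀ c, ¬ A.IsOrientedCycle c

/-! ### The blossoming quiver -/

noncomputable def inDegree (A : BoundQuiver.{u}) (v : A.V) : ℕ := {α | A.t α = v}.ncard

noncomputable def outDegree (A : BoundQuiver.{u}) (v : A.V) : ℕ := {α | A.s α = v}.ncard

/-- The source blossom vertices: `2 - inDegree v` of them for every vertex `v`. -/
def SourceBlossom (A : BoundQuiver.{u}) : Type u := Σ v : A.V, Fin (2 - A.inDegree v)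

/-- The sink blossom vertices: `2 - outDegree v` of them for every vertex `v`. -/
def SinkBlossom (A : BoundQuiver.{u}) : Type u := Σ v : A.V, Fin (2 - A.outDegree v)

/-- Vertices of the blossoming quiver. -/
inductive BlossomV (A : BoundQuiver.{u}) : Type u
  | old (v : A.V)
  | source (x : A.SourceBlossom)
  | sink (y : A.SinkBlossom)

/-- Arrows of the blossoming quiver: those of `Q`, an arrow `sig x` out of every source blossom
vertex `x`, and an arrow `tau y` into every sink blossom vertex `y`. -/
inductive BlossomE (A : BoundQuiver.{u}) : Type u
  | old (α : A.E)
  | sig (x : A.SourceBlossom)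
  | tau (y : A.SinkBlossom)

def blossomS (A : BoundQuiver.{u}) : A.BlossomE → A.BlossomV
  | .old α => .old (A.s α)
  | .sig x => .source x
  | .tau y => .old y.1

def blossomT (A : BoundQuiver.{u}) : A.BlossomE → A.BlossomV
  | .old α => .old (A.t α)
  | .sig x => .old x.1
  | .tau y => .sink y

/-- `B` is a blossoming of `A`: the quiver is the one described above, the relations between arrows
of `Q` are those of `I`, and `B` is locally gentle. -/
structure IsBlossomRel (A : BoundQuiver.{u}) (R : A.BlossomE → A.BlossomE → Prop)
    (hR : ∀ α β, R α β → A.blossomT α = A.blossomS β) : Prop where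
  extends_rel : ∀ α β : A.E, R (.old α) (.old β) ↔ A.rel α β
  locallyGentle : (BoundQuiver.mk A.BlossomV A.BlossomE A.blossomS A.blossomT R hR).IsLocallyGentle

section existence

variable {A : BoundQuiver.{u}}

theorem blossom_in_le (hA : A.IsLocallyGentle) (v : A.BlossomV) :
    {e | A.blossomT e = v}.encard ≤ 2 := by
  cases v with
  | old v =>
    have h1 : {e | A.blossomT e = .old v} ⊆
        BlossomE.old '' {α | A.t α = v} ∪
          (fun i : Fin (2 - A.inDegree v) => BlossomE.sig ⟨v, i⟩) '' Set.univ := by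
      rintro (α | ⟨w, i⟩ | y) h
      · exact Or.inl ⟨α, by simpa [blossomT] using h, rfl⟩
      · obtain rfl : w = v := by simpa [blossomT] using h
        exact Or.inr ⟨i, trivial, rfl⟩
      · simp [blossomT] at h
    refine (Set.encard_le_encard h1).trans ((Set.encard_union_le _ _).trans ?_)
    have hfin : {α | A.t α = v}.Finite :=
      Set.finite_of_encard_le_coe (k := 2) (by exact_mod_cast hA.in_le v)
    have h2 : {α | A.t α = v}.encard = (A.inDegree v : ℕ∞) := hfin.cast_ncard_eq.symm
    have h3 : A.inDegree v ≤ 2 := by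
      have := hA.in_le v
      rw [h2] at this
      exact_mod_cast this
    refine (add_le_add (Set.encard_image_le _ _) (Set.encard_image_le _ _)).trans ?_
    rw [h2, Set.encard_univ, ENat.card_eq_coe_fintype_card, Fintype.card_fin]
    norm_cast
    omega
  | source x =>
    have : {e | A.blossomT e = .source x} = ∅ := by
      ext e; cases e <;> simp [blossomT]
    simp [this]
  | sink y =>
    have : {e | A.blossomT e = .sink y} = {.tau y} := by
      ext e; cases e <;> simp [blossomT]
    simp [this]

theorem blossom_out_le (hA : A.IsLocallyGentle) (v : A.BlossomV) :
    {e | A.blossomS e = v}.encard ≤ 2 := by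
  cases v with
  | old v =>
    have h1 : {e | A.blossomS e = .old v} ⊆
        BlossomE.old '' {α | A.s α = v} ∪
          (fun i : Fin (2 - A.outDegree v) => BlossomE.tau ⟨v, i⟩) '' Set.univ := by
      rintro (α | x | ⟨w, i⟩) h
      · exact Or.inl ⟨α, by simpa [blossomS] using h, rfl⟩
      · simp [blossomS] at h
      · obtain rfl : w = v := by simpa [blossomS] using h
        exact Or.inr ⟨i, trivial, rfl⟩
    refine (Set.encard_le_encard h1).trans ((Set.encard_union_le _ _).trans ?_)
    have hfin : {α | A.s α = v}.Finite :=
      Set.finite_of_encard_le_coe (k := 2) (by exact_mod_cast hA.out_le v)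
    have h2 : {α | A.s α = v}.encard = (A.outDegree v : ℕ∞) := hfin.cast_ncard_eq.symm
    have h3 : A.outDegree v ≤ 2 := by
      have := hA.out_le v
      rw [h2] at this
      exact_mod_cast this
    refine (add_le_add (Set.encard_image_le _ _) (Set.encard_image_le _ _)).trans ?_
    rw [h2, Set.encard_univ, ENat.card_eq_coe_fintype_card, Fintype.card_fin]
    norm_cast
    omega
  | source x =>
    have : {e | A.blossomS e = .source x} = {.sig x} := by
      ext e; cases e <;> simp [blossomS]
    simp [this]
  | sink y =>
    have : {e | A.blossomS e = .sink y} = ∅ := by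
      ext e; cases e <;> simp [blossomS]
    simp [this]

theorem exists_bool_injOn {X : Type u} (S : Set X) (h : S.encard ≤ 2) :
    ∃ f : X → Bool, Set.InjOn f S := by
  classical
  rcases S.eq_empty_or_nonempty with rfl | ⟨x, hx⟩
  · exact ⟨fun _ => true, by simp⟩
  · refine ⟨fun y => decide (y = x), fun y hy z hz hyz => ?_⟩
    by_cases h1 : y = x
    · have : z = x := by simpa [h1] using hyz
      rw [h1, this]
    · have h2 : z ≠ x := by simpa [h1] using hyz
      by_contra h3
      have h4 : ({x, y, z} : Set X) ⊆ S := by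
        rintro a (rfl | rfl | rfl) <;> assumption
      have h5 : ({x, y, z} : Set X).encard = 3 :=
        Set.encard_eq_three.2 ⟨x, y, z, Ne.symm h1, Ne.symm h2, h3, rfl⟩
      have h6 := (Set.encard_le_encard h4).trans h
      rw [h5] at h6
      exact absurd h6 (by decide)

theorem exists_isBlossomRel (hA : A.IsLocallyGentle) :
    ∃ R, ∃ hR, A.IsBlossomRel R hR := by
  choose f hf using fun v => exists_bool_injOn _ (blossom_in_le hA (.old v))
  choose g hg using fun v => exists_bool_injOn _ (blossom_out_le hA (.old v))
  have key : ∀ v : A.V, ∃ b : Bool, ∀ α β : A.E, A.t α = v → A.s β = v →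
      (A.rel α β ↔ (f v (.old α) ^^ g v (.old β)) = b) := by
    intro v
    by_cases hv : ∃ α β : A.E, A.t α = v ∧ A.s β = v
    · obtain ⟨α, β, hα, hβ⟩ := hv
      have F : ∀ α₁ α₂ : A.E, A.t α₁ = v → A.t α₂ = v →
          f v (.old α₁) = f v (.old α₂) → α₁ = α₂ := by
        intro α₁ α₂ h1 h2 h
        have := hf v (x₁ := .old α₁) (by simp [blossomT, h1]) (x₂ := .old α₂)
          (by simp [blossomT, h2]) h
        simpa using this
      have G : ∀ β₁ β₂ : A.E, A.s β₁ = v → A.s β₂ = v →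
          g v (.old β₁) = g v (.old β₂) → β₁ = β₂ := by
        intro β₁ β₂ h1 h2 h
        have := hg v (x₁ := .old β₁) (by simp [blossomS, h1]) (x₂ := .old β₂)
          (by simp [blossomS, h2]) h
        simpa using this
      have FF : ∀ α₁ α₂ β : A.E, A.t α₁ = v → A.t α₂ = v → A.s β = v → α₁ ≠ α₂ →
          (A.rel α₁ β ↔ ¬ A.rel α₂ β) := by
        intro α₁ α₂ β h1 h2 h3 hne
        have ha := Set.encard_le_one_iff.1 (hA.rel_left β) α₁ α₂
        have hb := Set.encard_le_one_iff.1 (hA.nrel_left β) α₁ α₂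
        simp only [Set.mem_ofPred_eq, h1, h2, h3, true_and] at ha hb
        tauto
      have GG : ∀ α β₁ β₂ : A.E, A.t α = v → A.s β₁ = v → A.s β₂ = v → β₁ ≠ β₂ →
          (A.rel α β₁ ↔ ¬ A.rel α β₂) := by
        intro α β₁ β₂ h1 h2 h3 hne
        have ha := Set.encard_le_one_iff.1 (hA.rel_right α) β₁ β₂
        have hb := Set.encard_le_one_iff.1 (hA.nrel_right α) β₁ β₂
        simp only [Set.mem_ofPred_eq, h1, h2, h3, true_and] at ha hb
        tauto
      classical
      refine ⟨(f v (.old α) ^^ g v (.old β)) ^^ !decide (A.rel α β), ?_⟩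
      intro α' β' hα' hβ'
      have e1 : (A.rel α β' ↔ (A.rel α β ↔ g v (.old β) = g v (.old β'))) := by
        by_cases h : β = β'
        · subst h; simp
        · have h1 := GG α β β' hα hβ hβ' h
          have h2 : g v (.old β) ≠ g v (.old β') := fun h' => h (G _ _ hβ hβ' h')
          tauto
      have e2 : (A.rel α' β' ↔ (A.rel α β' ↔ f v (.old α) = f v (.old α'))) := by
        by_cases h : α = α'
        · subst h; simp
        · have h1 := FF α α' β' hα hα' hβ' h
          have h2 : f v (.old α) ≠ f v (.old α') := fun h' => h (F _ _ hα hα' h')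
          tauto
      rw [e2, e1]
      by_cases h : A.rel α β <;>
      cases f v (.old α) <;> cases f v (.old α') <;> cases g v (.old β) <;>
        cases g v (.old β') <;> simp [h]
    · exact ⟨true, fun α β h1 h2 => absurd ⟨α, β, h1, h2⟩ hv⟩
  choose b hb using key
  let R : A.BlossomE → A.BlossomE → Prop := fun x y =>
    ∃ v, A.blossomT x = .old v ∧ A.blossomS y = .old v ∧ (f v x ^^ g v y) = b v
  have hR : ∀ x y, R x y → A.blossomT x = A.blossomS y := by
    rintro x y ⟨v, h1, h2, -⟩
    rw [h1, h2]
  have mid : ∀ x y, A.blossomT x = A.blossomS y →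
      ∃ v, A.blossomT x = .old v ∧ A.blossomS y = .old v := by
    rintro (α | x | y) (α' | x' | y') h <;> simp_all [blossomS, blossomT]
  have val : ∀ x y v, A.blossomT x = .old v → A.blossomS y = .old v →
      (R x y ↔ (f v x ^^ g v y) = b v) := by
    intro x y v h1 h2
    constructor
    · rintro ⟨w, h3, -, h5⟩
      obtain rfl : v = w := by simpa [h1] using h3
      exact h5
    · exact fun h => ⟨v, h1, h2, h⟩
  refine ⟨R, hR, ⟨?_, ?_⟩⟩
  · intro α β
    constructor
    · rintro ⟨v, h1, h2, h3⟩
      exact (hb v α β (by simpa [blossomT] using h1) (by simpa [blossomS] using h2)).2 h3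
    · intro h
      exact ⟨A.t α, rfl, by simp [blossomS, A.rel_comp α β h],
        (hb _ α β rfl (A.rel_comp α β h).symm).1 h⟩
  · refine ⟨blossom_in_le hA, blossom_out_le hA, ?_, ?_, ?_, ?_⟩ <;> intro x <;>
      rw [Set.encard_le_one_iff] <;> rintro y z ⟨hy, hy'⟩ ⟨hz, hz'⟩ <;>
      simp only at hy hy' hz hz'
    · obtain ⟨v, h1, h2⟩ := mid y x hy
      have h3 : A.blossomT z = .old v := by rw [hz, h2]
      rw [val _ _ v h1 h2] at hy'
      rw [val _ _ v h3 h2] at hz'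
      refine hf v h1 h3 ?_
      revert hy' hz'
      cases f v y <;> cases f v z <;> cases g v x <;> cases b v <;> simp
    · obtain ⟨v, h1, h2⟩ := mid y x hy
      have h3 : A.blossomT z = .old v := by rw [hz, h2]
      rw [val _ _ v h1 h2] at hy'
      rw [val _ _ v h3 h2] at hz'
      refine hf v h1 h3 ?_
      revert hy' hz'
      cases f v y <;> cases f v z <;> cases g v x <;> cases b v <;> simp
    · obtain ⟨v, h1, h2⟩ := mid x y hy.symm
      have h3 : A.blossomS z = .old v := by rw [hz, h1]
      rw [val _ _ v h1 h2] at hy'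
      rw [val _ _ v h1 h3] at hz'
      refine hg v h2 h3 ?_
      revert hy' hz'
      cases g v y <;> cases g v z <;> cases f v x <;> cases b v <;> simp
    · obtain ⟨v, h1, h2⟩ := mid x y hy.symm
      have h3 : A.blossomS z = .old v := by rw [hz, h1]
      rw [val _ _ v h1 h2] at hy'
      rw [val _ _ v h1 h3] at hz'
      refine hg v h2 h3 ?_
      revert hy' hz'
      cases g v y <;> cases g v z <;> cases f v x <;> cases b v <;> simp

end existence

/-- The relations of the blossoming: relations added so that the result is locally gentle. They are
unique up to a relabelling of the blossom vertices. -/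
noncomputable def blossomRel (A : BoundQuiver.{u}) (hA : A.IsLocallyGentle) :
    A.BlossomE → A.BlossomE → Prop :=
  Classical.choose (exists_isBlossomRel hA)

theorem blossomRel_comp (A : BoundQuiver.{u}) (hA : A.IsLocallyGentle) :
    ∀ α β, A.blossomRel hA α β → A.blossomT α = A.blossomS β :=
  Classical.choose (Classical.choose_spec (exists_isBlossomRel hA))

theorem isBlossomRel_blossomRel (A : BoundQuiver.{u}) (hA : A.IsLocallyGentle) :
    A.IsBlossomRel (A.blossomRel hA) (A.blossomRel_comp hA) :=
  Classical.choose_spec (Classical.choose_spec (exists_isBlossomRel hA))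

/-- The blossoming of a locally gentle bound quiver. -/
noncomputable abbrev blossom (A : BoundQuiver.{u}) (hA : A.IsLocallyGentle) : BoundQuiver.{u} where
  V := A.BlossomV
  E := A.BlossomE
  s := A.blossomS
  t := A.blossomT
  rel := A.blossomRel hA
  rel_comp := A.blossomRel_comp hA

theorem blossom_isLocallyGentle (A : BoundQuiver.{u}) (hA : A.IsLocallyGentle) :
    (A.blossom hA).IsLocallyGentle :=
  (A.isBlossomRel_blossomRel hA).locallyGentle

/-- The common labels `p` of the source and the sink blossom vertices: a label is a pair of a source
blossom vertex `s_p` and a sink blossom vertex `t_p` that are connected by a maximal path of the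
blossoming (a maximal path that starts with `σ_p` and ends with `τ_p`). -/
@[ext]
structure Label (A : BoundQuiver.{u}) (hA : A.IsLocallyGentle) : Type u where
  src : A.SourceBlossom
  snk : A.SinkBlossom
  connected : ∃ w : List A.BlossomE, (A.blossom hA).IsMaxPath w ∧
    w.head? = some (.sig src) ∧ w.getLast? = some (.tau snk)

/-! ### Avella-Alaminos--Geiss invariants -/

/-- The maximal antipaths `Δ_p` of the blossoming. -/
def MaxAntipath (A : BoundQuiver.{u}) (hA : A.IsLocallyGentle) : Type u :=
  {w : List A.BlossomE // (A.blossom hA).IsMaxAntipath w}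

/-- The antipath `δ_p` of `A`, obtained from `Δ_p` by removing the first and the last arrow, which
are blossom arrows (the empty word stands for a trivial antipath `e_a`). -/
def MaxAntipath.delta {A : BoundQuiver.{u}} {hA : A.IsLocallyGentle} (D : A.MaxAntipath hA) :
    List A.BlossomE :=
  D.1.tail.dropLast

/-- The permutation `Φ`, as a relation: if `D = Δ_p` starts at `s_{p'}`, then `p' = Φ(p)`, and
`D' = Δ_{p'}` is the maximal antipath that ends at `t_{p'}`. -/
def PhiStep (A : BoundQuiver.{u}) (hA : A.IsLocallyGentle) (D D' : A.MaxAntipath hA) : Prop :=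
  ∃ p' : A.Label hA, D.1.head? = some (.sig p'.src) ∧ D'.1.getLast? = some (.tau p'.snk)

/-- The orbits of `Φ`. -/
def IsAGOrbit (A : BoundQuiver.{u}) (hA : A.IsLocallyGentle) (O : Set (A.MaxAntipath hA)) : Prop :=
  ∃ D, O = {D' | Relation.EqvGen (A.PhiStep hA) D D'}

/-- The type `(q, l)` of an orbit: its cardinality, and the sum of the lengths of its `δ_p`. -/
noncomputable def orbitType (A : BoundQuiver.{u}) (hA : A.IsLocallyGentle)
    (O : Set (A.MaxAntipath hA)) : ℕ × ℕ :=
  (O.ncard, ∑ᶠ D ∈ O, D.delta.length)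

/-- The invariant `φ_A(q, l)`. -/
noncomputable def phi (A : BoundQuiver.{u}) (hA : A.IsLocallyGentle) (q l : ℕ) : ℕ :=
  if q = 0 then {c : Cycle A.E | A.IsAnticycle c ∧ c.length = l}.ncard
  else {O : Set (A.MaxAntipath hA) | A.IsAGOrbit hA O ∧ A.orbitType hA O = (q, l)}.ncard

/-! ### Finite gentle repetitions -/

/-- Arrows of `Q^(k)`, where `L` is the type of labels of `A`: `k` copies of the arrows of `Q`, on
the sheets `0, …, k - 1`, and for every label `p` and every `i < k - 1` a connecting arrow `weld p i`, which arises by welding `τ_p` on the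
sheet `i` and `σ_p` on the sheet `i + 1`. -/
inductive RepE (A : BoundQuiver.{u}) (L : Type u) (k : ℕ) : Type u
  | copy (α : A.E) (i : Fin k)
  | weld (p : L) (i : Fin (k - 1))

namespace RepE

variable {A : BoundQuiver.{u}} {hA : A.IsLocallyGentle} {k : ℕ}

/-- The sheet that contains the source. -/
def sourceSheet : RepE A (A.Label hA) k → Fin k
  | copy _ i => i
  | weld _ i => ⟨i, by omega⟩

/-- The sheet that contains the target. -/
def targetSheet : RepE A (A.Label hA) k → Fin k
  | copy _ i => i
  | weld _ i => ⟨i + 1, by omega⟩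

/-- The arrow of the blossoming which the arrow extends on the sheet that contains its source. -/
def outArrow : RepE A (A.Label hA) k → A.BlossomE
  | copy α _ => .old α
  | weld p _ => .tau p.snk

/-- The arrow of the blossoming which the arrow extends on the sheet that contains its target. -/
def inArrow : RepE A (A.Label hA) k → A.BlossomE
  | copy α _ => .old α
  | weld p _ => .sig p.src

/-- The vertex of `Q` below the source, which is the source of `τ_p` for a connecting arrow. -/
def sourceVertex : RepE A (A.Label hA) k → A.V
  | copy α _ => A.s α
  | weld p _ => p.snk.1

/-- The vertex of `Q` below the target, which is the target of `σ_p` for a connecting arrow. -/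
def targetVertex : RepE A (A.Label hA) k → A.V
  | copy α _ => A.t α
  | weld p _ => p.src.1

theorem blossomS_outArrow (x : RepE A (A.Label hA) k) :
    A.blossomS x.outArrow = .old x.sourceVertex := by
  cases x <;> rfl

theorem blossomT_inArrow (x : RepE A (A.Label hA) k) :
    A.blossomT x.inArrow = .old x.targetVertex := by
  cases x <;> rfl

end RepE

/-- The bound quiver `(Q^(k), I^(k))` of the `k`-th finite gentle repetition `A^(k)`, for `k ≥ 1`.
The product `xy` of two arrows is a relation exactly if `x` ends on the sheet on which `y` starts,
and the arrows of the blossoming that `x` and `y` extend on this sheet form a relation there. -/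
noncomputable abbrev repetition (A : BoundQuiver.{u}) (hA : A.IsLocallyGentle) (k : ℕ) :
    BoundQuiver.{u} where
  V := A.V × Fin k
  E := RepE A (A.Label hA) k
  s x := (x.sourceVertex, x.sourceSheet)
  t x := (x.targetVertex, x.targetSheet)
  rel x y := x.targetSheet = y.sourceSheet ∧ A.blossomRel hA x.inArrow y.outArrow
  rel_comp x y h := by
    have := A.blossomRel_comp hA _ _ h.2
    rw [RepE.blossomT_inArrow, RepE.blossomS_outArrow] at this
    exact Prod.ext (BlossomV.old.inj this) h.1

section repetitionGentle

theorem isChain_eq_of_head {X : Type u} {r : X → X → Prop}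
    (hr : ∀ x y z, r x y → r x z → y = z) :
    ∀ (l l' : List X) (x : X), (x :: l).IsChain r → (x :: l').IsChain r →
      (∀ z, ¬ (x :: l ++ [z]).IsChain r) → (∀ z, ¬ (x :: l' ++ [z]).IsChain r) → l = l'
  | [], [], _, _, _, _, _ => rfl
  | [], y :: l', x, _, h2, h3, _ =>
    absurd (by simpa using (List.isChain_cons_cons.1 h2).1) (h3 y)
  | y :: l, [], x, h1, _, _, h4 =>
    absurd (by simpa using (List.isChain_cons_cons.1 h1).1) (h4 y)
  | y :: l, y' :: l', x, h1, h2, h3, h4 => by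
    rw [List.isChain_cons_cons] at h1 h2
    obtain rfl := hr _ _ _ h1.1 h2.1
    congr 1
    refine isChain_eq_of_head hr l l' y h1.2 h2.2 (fun z hz => h3 z ?_) (fun z hz => h4 z ?_)
    · exact List.isChain_cons_cons.2 ⟨h1.1, hz⟩
    · exact List.isChain_cons_cons.2 ⟨h2.1, hz⟩

theorem _root_.IsMaximalWord.eq_of_head {X : Type u} {r : X → X → Prop}
    (hr : ∀ x y z, r x y → r x z → y = z) {w w' : List X} (hw : IsMaximalWord r w)
    (hw' : IsMaximalWord r w') (h : w.head? = w'.head?) : w = w' := by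
  cases w with
  | nil => exact absurd rfl hw.ne_nil
  | cons x l =>
    cases w' with
    | nil => exact absurd rfl hw'.ne_nil
    | cons x' l' =>
      obtain rfl : x = x' := by simpa using h
      rw [isChain_eq_of_head hr l l' x hw.chain hw'.chain hw.right hw'.right]

theorem _root_.IsMaximalWord.reverse {X : Type u} {r : X → X → Prop} {w : List X}
    (hw : IsMaximalWord r w) : IsMaximalWord (fun x y => r y x) w.reverse where
  ne_nil := by simpa using hw.ne_nil
  chain := List.isChain_reverse.2 hw.chain
  left x h := hw.right x (by
    have := List.isChain_reverse.2 h
    simpa using this)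
  right x h := hw.left x (by
    have := List.isChain_reverse.2 h
    simpa using this)

variable {A : BoundQuiver.{u}} {hA : A.IsLocallyGentle}

theorem Label.ext_src {p p' : A.Label hA} (h : p.src = p'.src) : p = p' := by
  obtain ⟨w, hw, h1, h2⟩ := p.connected
  obtain ⟨w', hw', h1', h2'⟩ := p'.connected
  have hB := A.blossom_isLocallyGentle hA
  obtain rfl : w = w' := by
    refine IsMaximalWord.eq_of_head ?_ hw hw' (by rw [h1, h1', h])
    intro x y z hy hz
    exact Set.encard_le_one_iff.1 (hB.nrel_right x) y z ⟨hy.1.symm, hy.2⟩ ⟨hz.1.symm, hz.2⟩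
  refine Label.ext h ?_
  rw [h2] at h2'
  simpa using h2'

theorem Label.ext_snk {p p' : A.Label hA} (h : p.snk = p'.snk) : p = p' := by
  obtain ⟨w, hw, h1, h2⟩ := p.connected
  obtain ⟨w', hw', h1', h2'⟩ := p'.connected
  have hB := A.blossom_isLocallyGentle hA
  obtain rfl : w = w' := by
    have := IsMaximalWord.eq_of_head ?_ hw.reverse hw'.reverse
      (by rw [List.head?_reverse, List.head?_reverse, h2, h2', h])
    · exact List.reverse_injective this
    · intro x y z hy hz
      exact Set.encard_le_one_iff.1 (hB.nrel_left x) y z hy hz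
  refine Label.ext ?_ h
  rw [h1] at h1'
  simpa using h1'

variable {k : ℕ}

theorem RepE.ext_in {x y : RepE A (A.Label hA) k} (h : x.inArrow = y.inArrow)
    (h' : x.targetSheet = y.targetSheet) : x = y := by
  cases x with
  | copy α i =>
    cases y with
    | copy β j => simp_all [inArrow, targetSheet]
    | weld p j => simp [inArrow] at h
  | weld p i =>
    cases y with
    | copy β j => simp [inArrow] at h
    | weld p' j =>
      obtain rfl := Label.ext_src (p := p) (p' := p') (by simpa [inArrow] using h)
      have : i = j := by
        ext
        simpa [targetSheet] using h'
      rw [this]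

theorem RepE.ext_out {x y : RepE A (A.Label hA) k} (h : x.outArrow = y.outArrow)
    (h' : x.sourceSheet = y.sourceSheet) : x = y := by
  cases x with
  | copy α i =>
    cases y with
    | copy β j => simp_all [outArrow, sourceSheet]
    | weld p j => simp [outArrow] at h
  | weld p i =>
    cases y with
    | copy β j => simp [outArrow] at h
    | weld p' j =>
      obtain rfl := Label.ext_snk (p := p) (p' := p') (by simpa [outArrow] using h)
      have : i = j := by
        ext
        simpa [sourceSheet] using h'
      rw [this]

end repetitionGentle

theorem repetition_isLocallyGentle (A : BoundQuiver.{u}) (hA : A.IsLocallyGentle) (k : ℕ) :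
    (A.repetition hA k).IsLocallyGentle := by
  have hB := A.blossom_isLocallyGentle hA
  refine ⟨?_, ?_, ?_, ?_, ?_, ?_⟩
  · rintro ⟨v, i⟩
    refine le_trans (Set.encard_le_encard_of_injOn (f := RepE.inArrow) ?_ ?_) (hB.in_le (.old v))
    · intro x hx
      exact (RepE.blossomT_inArrow x).trans (congrArg _ (Prod.ext_iff.1 hx).1)
    · intro x hx y hy h
      exact RepE.ext_in h ((Prod.ext_iff.1 hx).2.trans (Prod.ext_iff.1 hy).2.symm)
  · rintro ⟨v, i⟩
    refine le_trans (Set.encard_le_encard_of_injOn (f := RepE.outArrow) ?_ ?_) (hB.out_le (.old v))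
    · intro x hx
      exact (RepE.blossomS_outArrow x).trans (congrArg _ (Prod.ext_iff.1 hx).1)
    · intro x hx y hy h
      exact RepE.ext_out h ((Prod.ext_iff.1 hx).2.trans (Prod.ext_iff.1 hy).2.symm)
  · intro z
    refine le_trans (Set.encard_le_encard_of_injOn (f := RepE.inArrow) ?_ ?_)
      (hB.rel_left (RepE.outArrow z))
    · intro x hx
      exact ⟨A.blossomRel_comp hA _ _ hx.2.2, hx.2.2⟩
    · intro x hx y hy h
      exact RepE.ext_in h (hx.2.1.trans hy.2.1.symm)
  · intro z
    refine le_trans (Set.encard_le_encard_of_injOn (f := RepE.inArrow) ?_ ?_)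
      (hB.nrel_left (RepE.outArrow z))
    · intro x hx
      refine ⟨?_, fun h => hx.2 ⟨(Prod.ext_iff.1 hx.1).2, h⟩⟩
      exact (RepE.blossomT_inArrow x).trans
        ((congrArg _ (Prod.ext_iff.1 hx.1).1).trans (RepE.blossomS_outArrow z).symm)
    · intro x hx y hy h
      exact RepE.ext_in h ((Prod.ext_iff.1 hx.1).2.trans (Prod.ext_iff.1 hy.1).2.symm)
  · intro z
    refine le_trans (Set.encard_le_encard_of_injOn (f := RepE.outArrow) ?_ ?_)
      (hB.rel_right (RepE.inArrow z))
    · intro x hx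
      exact ⟨(A.blossomRel_comp hA _ _ hx.2.2).symm, hx.2.2⟩
    · intro x hx y hy h
      exact RepE.ext_out h (hx.2.1.symm.trans hy.2.1)
  · intro z
    refine le_trans (Set.encard_le_encard_of_injOn (f := RepE.outArrow) ?_ ?_)
      (hB.nrel_right (RepE.inArrow z))
    · intro x hx
      refine ⟨?_, fun h => hx.2 ⟨(Prod.ext_iff.1 hx.1).2.symm, h⟩⟩
      exact (RepE.blossomS_outArrow x).trans
        ((congrArg _ (Prod.ext_iff.1 hx.1).1).trans (RepE.blossomT_inArrow z).symm)
    · intro x hx y hy h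
      exact RepE.ext_out h ((Prod.ext_iff.1 hx.1).2.trans (Prod.ext_iff.1 hy.1).2.symm)

end BoundQuiver

/-!
The idea is to replace the blossoming by a permutation of a finite set. At every vertex `v` of `Q`
the blossoming has two incoming and two outgoing arrows, and the relations match the former with the
latter. So there are two *slots* at `v`, each of which is entered by one arrow and left by another,
such that a product of two arrows is a relation if and only if it stays in one slot, and a path in
the algebra if and only if it changes to the other slot (`BlossomSlots`, `permitted_iff`). Let `P`
(`BlossomSlots.next`) be the permutation of the slots that takes the slot left by an arrow of `Q` to
the slot which it enters, and the slot left by `τ_p` to the slot entered by `σ_p`; call the slots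
left by the `τ_p` terminal.

A maximal antipath `Δ_p` runs through a segment of a `P`-cycle of which only the last slot is
terminal, and it passes one slot more than `δ_p` has arrows. The segments of a cycle follow each
other in the order opposite to `Φ`. Hence an orbit of `Φ` of type `(q, l)` is a `P`-cycle with
`q + l` slots, `q` of which are terminal, so that `q * φ_A(q, l)` is the number of terminal slots on
such cycles (`IsThreading.mul_ncard_orbits`, `BlossomSlots.mul_phi`).

The slots of `A^(k)` are `k` copies of those of `A`. Its permutation is the `k`-sheeted cyclic
covering of `P` that moves on to the next sheet exactly behind a terminal slot, from the last sheet
back to the first one, because the maximal path from `σ_p` to `τ_p` is repeated on all sheets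
(`BlossomSlots.exists_isCyclicCover`). This uses that an assignment of slots for `A^(k)` extends to
whatever relations were chosen for the blossoming of `A^(k)` (`Slots.exists_extension`). The terminal
slots of `A^(k)` are those on the last sheet, and a cycle of the covering with exactly one terminal
slot and with `n` slots lies over a cycle with `r` terminal slots and `m` slots such that
`(k, n) = (u * r, u * m)` for some `u` (`IsCyclicCover.ncard_eq`). Hence `φ` of `A^(k)` at
`(1, n - 1)` is a divisor sum of the numbers `q * φ_A(q, l)`, and Möbius inversion
(`ncard_eq_sum_moebius`) yields the formula.
-/

/-! ### Visits of an orbit to a set, and cyclic covers -/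

section visits

variable {H H' : Type*}

open Function

open Classical in
/-- The number of times `0 ≤ j < n` at which the orbit of `h` under `P` is in `T`. -/
noncomputable def visits (P : H → H) (T : Set H) (h : H) (n : ℕ) : ℕ :=
  Nat.count (fun j => P^[j] h ∈ T) n

open Classical in
theorem visits_succ (P : H → H) (T : Set H) (h : H) (n : ℕ) :
    visits P T h (n + 1) = visits P T h n + if P^[n] h ∈ T then 1 else 0 := by
  simp [visits, Nat.count_succ]

theorem visits_add (P : H → H) (T : Set H) (h : H) (m n : ℕ) :
    visits P T h (m + n) = visits P T h m + visits P T (P^[m] h) n := by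
  have h1 : ∀ k, P^[m + k] h = P^[k] (P^[m] h) := fun k => by rw [add_comm, iterate_add_apply]
  rw [visits, Nat.count_add, visits, visits]
  congr! 3
  rw [h1]

theorem visits_mul_of_isPeriodicPt {P : H → H} (T : Set H) {h : H} {m : ℕ}
    (hm : IsPeriodicPt P m h) (k : ℕ) : visits P T h (k * m) = k * visits P T h m := by
  induction k with
  | zero => simp [visits]
  | succ k ih =>
    rw [Nat.succ_mul, visits_add, ih, Nat.succ_mul, (hm.const_mul k).eq]

theorem visits_pos {P : H → H} {T : Set H} {h : H} (hh : h ∈ T) {n : ℕ} (hn : 0 < n) :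
    0 < visits P T h n := by
  obtain ⟨n, rfl⟩ := Nat.exists_eq_add_of_le (Nat.succ_le_of_lt hn)
  rw [visits_add, visits_succ]
  simp [hh]

/-- The number of elements of `T` in the `P`-cycle of `h`. -/
noncomputable def cycleVisits (P : H → H) (T : Set H) (h : H) : ℕ :=
  visits P T h (minimalPeriod P h)

/-- `Q` is a cyclic covering of `P` with `k` sheets on which the sheet is changed exactly at the
elements of `T`, and `T'` is the part of the preimage of `T` on the last sheet. -/
structure IsCyclicCover {k : ℕ} (P : H → H) (T : Set H) (e : H × Fin k ≃ H') (Q : H' → H')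
    (T' : Set H') : Prop where
  apply_of_mem : ∀ h ∈ T, ∀ i j : Fin k, (j : ℕ) = (i + 1) % k → Q (e (h, i)) = e (P h, j)
  apply_of_notMem : ∀ h ∉ T, ∀ i, Q (e (h, i)) = e (P h, i)
  mem_iff : ∀ h i, e (h, i) ∈ T' ↔ h ∈ T ∧ (i : ℕ) + 1 = k

namespace IsCyclicCover

variable {k : ℕ} {P : H → H} {T : Set H} {e : H × Fin k ≃ H'} {Q : H' → H'} {T' : Set H'}

theorem iterate_apply (hc : IsCyclicCover P T e Q T') (h : H) (i : Fin k) (n : ℕ) :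
    Q^[n] (e (h, i)) =
      e (P^[n] h, ⟨(i + visits P T h n) % k, Nat.mod_lt _ (Fin.pos i)⟩) := by
  induction n with
  | zero => simp [visits, Nat.mod_eq_of_lt i.2]
  | succ n ih =>
    rw [iterate_succ_apply', ih, iterate_succ_apply']
    by_cases hn : P^[n] h ∈ T
    · refine hc.apply_of_mem _ hn _ _ ?_
      simp [visits_succ, hn, Nat.add_assoc]
    · rw [hc.apply_of_notMem _ hn]
      simp [visits_succ, hn]

/-- The orbit that starts on the last sheet is on it again whenever the number of changes of sheet
is a multiple of `k`. -/
theorem pred_add_mod_eq (hk : 0 < k) (a : ℕ) : (k - 1 + a) % k = k - 1 ↔ k ∣ a := by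
  have h : k - 1 + a ≡ k - 1 + 0 [MOD k] ↔ a ≡ 0 [MOD k] :=
    ⟨Nat.ModEq.add_left_cancel' _, Nat.ModEq.add_left _⟩
  rwa [Nat.ModEq, Nat.add_zero, Nat.mod_eq_of_lt (show k - 1 < k by omega),
    Nat.modEq_zero_iff_dvd] at h

theorem isPeriodicPt_iff (hc : IsCyclicCover P T e Q T') (hk : 0 < k) (h : H) (n : ℕ) :
    IsPeriodicPt Q n (e (h, ⟨k - 1, by omega⟩)) ↔ IsPeriodicPt P n h ∧ k ∣ visits P T h n := by
  rw [IsPeriodicPt, IsFixedPt, hc.iterate_apply, e.apply_eq_iff_eq, Prod.mk.injEq, Fin.mk.injEq,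
    pred_add_mod_eq hk]
  rfl

/-- Of the visits to `T` below, those numbered `0, k, 2k, …` are visits to `T'`. -/
theorem visits_eq (hc : IsCyclicCover P T e Q T') (hk : 0 < k) (h : H) (n : ℕ) :
    visits Q T' (e (h, ⟨k - 1, by omega⟩)) n = (visits P T h n + k - 1) / k := by
  induction n with
  | zero => simp [visits, Nat.div_eq_of_lt (show k - 1 < k by omega)]
  | succ n ih =>
    have h1 : Q^[n] (e (h, ⟨k - 1, by omega⟩)) ∈ T' ↔ P^[n] h ∈ T ∧ k ∣ visits P T h n := by
      rw [hc.iterate_apply, hc.mem_iff, ← pred_add_mod_eq hk]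
      refine and_congr_right fun _ => ?_
      simp only
      omega
    rw [visits_succ, ih, visits_succ]
    by_cases hT : P^[n] h ∈ T
    · have h2 : visits P T h n + 1 + k - 1 = (visits P T h n + k - 1) + 1 := by omega
      simp only [h1, hT, true_and, if_true]
      rw [h2, Nat.succ_div]
      have h3 : visits P T h n + k - 1 + 1 = visits P T h n + k := by omega
      simp [h3]
    · simp [h1, hT]

/-- The cycle of a point of the covering over `h ∈ T` meets `T'` only once exactly if it winds
round the cycle of `h` so often, `u` times, that it passes through `T` exactly `k` times. -/
theorem cycleVisits_eq_one_iff [Finite H] (hc : IsCyclicCover P T e Q T') (hk : 0 < k)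
    (hP : P.Injective) {h : H} (hh : h ∈ T) {n : ℕ} (hn : 0 < n) :
    (cycleVisits Q T' (e (h, ⟨k - 1, by omega⟩)) = 1 ∧
      minimalPeriod Q (e (h, ⟨k - 1, by omega⟩)) = n) ↔
    ∃ u, n = u * minimalPeriod P h ∧ k = u * cycleVisits P T h := by
  set x := e (h, ⟨k - 1, by omega⟩) with hx
  have hm : 0 < minimalPeriod P h := minimalPeriod_pos_of_mem_periodicPts (hP.mem_periodicPts h)
  have hv : ∀ N, IsPeriodicPt P N h →
      ∃ u, N = u * minimalPeriod P h ∧ visits P T h N = u * cycleVisits P T h := by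
    intro N hN
    obtain ⟨u, rfl⟩ := hN.minimalPeriod_dvd
    exact ⟨u, mul_comm _ _, by
      rw [mul_comm, visits_mul_of_isPeriodicPt T (isPeriodicPt_minimalPeriod P h)]; rfl⟩
  have hN := (hc.isPeriodicPt_iff hk h _).1 (isPeriodicPt_minimalPeriod Q x)
  have hcv : cycleVisits Q T' x = (visits P T h (minimalPeriod Q x) + k - 1) / k :=
    hc.visits_eq hk h _
  have hr : 0 < cycleVisits P T h := visits_pos hh hm
  constructor
  · rintro ⟨h1, hxn⟩
    rw [hxn] at hN hcv
    obtain ⟨u, h2, h3⟩ := hv _ hN.1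
    refine ⟨u, h2, ?_⟩
    rw [← h3]
    obtain ⟨b, hb⟩ := hN.2
    rw [hcv, hb] at h1
    have hpos := visits_pos (P := P) hh hn
    have h4 : (k * b + k - 1) / k = b := by
      rw [Nat.add_sub_assoc hk, Nat.mul_add_div hk, Nat.div_eq_of_lt (show k - 1 < k by omega),
        add_zero]
    rw [hb, ← h4, h1, mul_one]
  · rintro ⟨u, h1, h2⟩
    have hper : IsPeriodicPt P n h := by
      rw [h1]; exact (isPeriodicPt_minimalPeriod P h).const_mul u
    have hvn : visits P T h n = k := by
      rw [h1, visits_mul_of_isPeriodicPt T (isPeriodicPt_minimalPeriod P h), h2]; rfl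
    have hQn : IsPeriodicPt Q n x := (hc.isPeriodicPt_iff hk h n).2 ⟨hper, by rw [hvn]⟩
    obtain ⟨w, hw⟩ := hQn.minimalPeriod_dvd
    have hNpos : 0 < minimalPeriod Q x := hQn.minimalPeriod_pos hn
    have hwv : k = w * visits P T h (minimalPeriod Q x) := by
      rw [← visits_mul_of_isPeriodicPt T hN.1, mul_comm, ← hw, hvn]
    have hvk : visits P T h (minimalPeriod Q x) = k :=
      Nat.dvd_antisymm ⟨w, by rw [mul_comm]; exact hwv⟩ hN.2
    have hw1 : w = 1 := by
      rw [hvk] at hwv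
      exact Nat.eq_of_mul_eq_mul_right hk (by rw [one_mul]; exact hwv.symm)
    refine ⟨?_, by rw [hw, hw1, mul_one]⟩
    rw [hcv, hvk, show k + k - 1 = k + (k - 1) by omega, Nat.add_div_left _ hk,
      Nat.div_eq_of_lt (show k - 1 < k by omega)]

/-- Each point of `T'` lies over one point of `T`, so the cycles of the covering that meet `T'` only
once are counted on the cycles of `P`. -/
theorem ncard_eq [Finite H] (hc : IsCyclicCover P T e Q T') (hk : 0 < k) (hP : P.Injective)
    {n : ℕ} (hn : 0 < n) :
    {x | x ∈ T' ∧ cycleVisits Q T' x = 1 ∧ minimalPeriod Q x = n}.ncard =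
      {h | h ∈ T ∧ ∃ u, n = u * minimalPeriod P h ∧ k = u * cycleVisits P T h}.ncard := by
  have hinj : Injective fun h => e (h, (⟨k - 1, by omega⟩ : Fin k)) := fun a b hab => by
    simpa using hab
  rw [← Set.ncard_image_of_injective _ hinj]
  congr 1
  ext x
  constructor
  · rintro ⟨h1, h2⟩
    obtain ⟨⟨h, i⟩, rfl⟩ := e.surjective x
    obtain ⟨h3, h4⟩ := (hc.mem_iff h i).1 h1
    obtain rfl : i = ⟨k - 1, Nat.sub_lt hk one_pos⟩ := Fin.ext (by simp only; omega)
    exact ⟨h, ⟨h3, (hc.cycleVisits_eq_one_iff hk hP h3 hn).1 h2⟩, rfl⟩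
  · rintro ⟨h, ⟨h1, h2⟩, rfl⟩
    exact ⟨(hc.mem_iff _ _).2 ⟨h1, by simp only; omega⟩,
      (hc.cycleVisits_eq_one_iff hk hP h1 hn).2 h2⟩

end IsCyclicCover

/-- Möbius inversion along the multiples of a fixed primitive type: a point of type `(r, m)` is
counted by the pairs `(u * r, u * m)`. -/
theorem ncard_eq_sum_moebius [Finite H] (T : Set H) (r m : H → ℕ) {q n : ℕ} (hq : 0 < q) :
    ({h | h ∈ T ∧ r h = q ∧ m h = n}.ncard : ℤ) =
      ∑ c ∈ (Nat.gcd q n).divisors, ArithmeticFunction.moebius c *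
        ({h | h ∈ T ∧ ∃ u, n / c = u * m h ∧ q / c = u * r h}.ncard : ℤ) := by
  classical
  have := Fintype.ofFinite H
  obtain ⟨d, q₀, n₀, hd, hco, rfl, rfl⟩ := Nat.exists_coprime' (m := q) (n := n)
    (Nat.gcd_pos_of_pos_left _ hq)
  have hq₀ : 0 < q₀ := Nat.pos_of_mul_pos_right hq
  have hgcd : Nat.gcd (q₀ * d) (n₀ * d) = d := by
    rw [Nat.gcd_mul_right, hco.gcd_eq_one, one_mul]
  rw [hgcd]
  have key : ∀ i : ℕ, 0 < i →
      ∑ b ∈ i.divisors, ({h | h ∈ T ∧ r h = q₀ * b ∧ m h = n₀ * b}.ncard : ℤ) =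
        ({h | h ∈ T ∧ ∃ u, n₀ * i = u * m h ∧ q₀ * i = u * r h}.ncard : ℤ) := by
    intro i hi
    simp only [Set.ncard_eq_toFinset_card', Set.toFinset_ofPred]
    rw [Finset.card_eq_sum_card_fiberwise (f := fun h => Nat.gcd (r h) (m h)) (t := i.divisors)]
    · push_cast
      refine Finset.sum_congr rfl fun b hb => ?_
      rw [Finset.filter_filter]
      congr 2
      ext h
      simp only [Finset.mem_filter, Finset.mem_univ, true_and]
      obtain ⟨w, hw⟩ := (Nat.mem_divisors.1 hb).1
      constructor
      · rintro ⟨h1, h2, h3⟩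
        refine ⟨⟨h1, w, by rw [h3, hw]; ring, by rw [h2, hw]; ring⟩, ?_⟩
        rw [h2, h3, Nat.gcd_mul_right, hco.gcd_eq_one, one_mul]
      · rintro ⟨⟨h1, u, h2, h3⟩, h4⟩
        have h5 : i = u * b := by
          have : Nat.gcd (q₀ * i) (n₀ * i) = i := by
            rw [Nat.gcd_mul_right, hco.gcd_eq_one, one_mul]
          rw [h2, h3, Nat.gcd_mul_left, h4] at this
          exact this.symm
        have hu : 0 < u := by
          rcases Nat.eq_zero_or_pos u with rfl | h
          · simp at h5; omega
          · exact h
        refine ⟨h1, Nat.eq_of_mul_eq_mul_left hu ?_, Nat.eq_of_mul_eq_mul_left hu ?_⟩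
        · rw [← h3, h5]; ring
        · rw [← h2, h5]; ring
    · intro h hh
      simp only [Finset.coe_filter, Finset.mem_univ, true_and, Set.mem_ofPred_eq] at hh
      obtain ⟨-, u, h2, h3⟩ := hh
      have : Nat.gcd (q₀ * i) (n₀ * i) = i := by
        rw [Nat.gcd_mul_right, hco.gcd_eq_one, one_mul]
      rw [h2, h3, Nat.gcd_mul_left] at this
      simp only [Finset.mem_coe, Nat.mem_divisors]
      exact ⟨⟨u, by rw [mul_comm]; exact this.symm⟩, hi.ne'⟩
  have := (ArithmeticFunction.sum_eq_iff_sum_mul_moebius_eq.1 key) d hd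
  simp only [Int.cast_id] at this
  rw [← this, Nat.sum_divisorsAntidiagonal
    (f := fun x y => (ArithmeticFunction.moebius x : ℤ) *
      ({h | h ∈ T ∧ ∃ u, n₀ * y = u * m h ∧ q₀ * y = u * r h}.ncard : ℤ))]
  refine Finset.sum_congr rfl fun c hc => ?_
  have hcd := (Nat.mem_divisors.1 hc).1
  rw [Nat.mul_div_assoc _ hcd, Nat.mul_div_assoc _ hcd]

end visits

namespace BoundQuiver

/-! ### Slots -/

/-- The set of slots of `A`: two at every vertex. The arrows that enter a vertex of the blossoming,
and likewise those that leave it, occupy its two slots, in such a way that a product of two arrows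
is a relation exactly if the slot entered by the first is the slot left by the second. -/
abbrev Slot (A : BoundQuiver.{u}) : Type u := A.V × Bool

/-- The other slot at the same vertex. -/
def Slot.flip {A : BoundQuiver.{u}} (h : A.Slot) : A.Slot := (h.1, !h.2)

@[simp]
theorem Slot.flip_flip {A : BoundQuiver.{u}} (h : A.Slot) : Slot.flip (Slot.flip h) = h := by
  simp [Slot.flip]

theorem Slot.eq_flip_iff {A : BoundQuiver.{u}} {g h : A.Slot} :
    g = Slot.flip h ↔ g.1 = h.1 ∧ g ≠ h := by
  obtain ⟨v, b⟩ := g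
  obtain ⟨w, c⟩ := h
  simp only [Slot.flip, Prod.mk.injEq, ne_eq]
  refine and_congr_right fun h1 => ?_
  cases b <;> cases c <;> simp [h1]

/-- An assignment of slots to the ends of the arrows of `A` itself: `inn α` is the slot which `α`
enters, and `out α` the slot which it leaves. -/
structure Slots (A : BoundQuiver.{u}) where
  inn : A.E → A.Slot
  out : A.E → A.Slot
  inn_fst : ∀ α, (inn α).1 = A.t α
  out_fst : ∀ α, (out α).1 = A.s α
  inn_inj : inn.Injective
  out_inj : out.Injective
  rel_iff : ∀ α β, A.rel α β ↔ inn α = out β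

variable {A : BoundQuiver.{u}} {hA : A.IsLocallyGentle}

/-- The slot which an arrow of the blossoming enters, if any, when `f` and `g` give the slots of the
arrows of `Q` and of the arrows `σ_p`. -/
def BlossomE.slotIn (f : A.E → A.Slot) (g : A.SourceBlossom → A.Slot) : A.BlossomE → Option A.Slot
  | .old α => some (f α)
  | .sig x => some (g x)
  | .tau _ => none

/-- The slot which an arrow of the blossoming leaves, if any, when `f` and `g` give the slots of the
arrows of `Q` and of the arrows `τ_p`. -/
def BlossomE.slotOut (f : A.E → A.Slot) (g : A.SinkBlossom → A.Slot) : A.BlossomE → Option A.Slot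
  | .old α => some (f α)
  | .sig _ => none
  | .tau y => some (g y)

/-- An assignment of slots to the ends of the arrows of the blossoming: besides the slots of the
arrows of `Q`, these are the slots entered by the arrows `σ_p` and left by the arrows `τ_p`. Every
slot is entered by exactly one arrow and left by exactly one arrow. -/
structure BlossomSlots (A : BoundQuiver.{u}) (hA : A.IsLocallyGentle) where
  inn : A.E → A.Slot
  out : A.E → A.Slot
  sig : A.SourceBlossom → A.Slot
  tau : A.SinkBlossom → A.Slot
  inn_fst : ∀ α, (inn α).1 = A.t α
  out_fst : ∀ α, (out α).1 = A.s α
  sig_fst : ∀ x, (sig x).1 = x.1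
  tau_fst : ∀ y, (tau y).1 = y.1
  in_unique : ∀ h, ∃! x, BlossomE.slotIn inn sig x = some h
  out_unique : ∀ h, ∃! x, BlossomE.slotOut out tau x = some h
  rel_iff : ∀ x y, A.blossomRel hA x y ↔
    ∃ h, BlossomE.slotIn inn sig x = some h ∧ BlossomE.slotOut out tau y = some h

theorem ncard_blossomT_eq_two (hA : A.IsLocallyGentle) (v : A.V) :
    {e | A.blossomT e = .old v}.ncard = 2 := by
  have hfin : {α | A.t α = v}.Finite :=
    Set.finite_of_encard_le_coe (k := 2) (by exact_mod_cast hA.in_le v)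
  have h3 : A.inDegree v ≤ 2 := by
    have := hA.in_le v
    rw [← hfin.cast_ncard_eq] at this
    exact_mod_cast this
  have h1 : {e | A.blossomT e = .old v} =
      BlossomE.old '' {α | A.t α = v} ∪
        (fun i : Fin (2 - A.inDegree v) => BlossomE.sig ⟨v, i⟩) '' Set.univ := by
    ext e
    constructor
    · intro h
      rcases e with α | ⟨w, i⟩ | y
      · exact Or.inl ⟨α, by simpa [blossomT] using h, rfl⟩
      · obtain rfl : w = v := by simpa [blossomT] using h
        exact Or.inr ⟨i, trivial, rfl⟩
      · simp [blossomT] at h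
    · rintro (⟨α, rfl, rfl⟩ | ⟨i, -, rfl⟩) <;> rfl
  rw [h1, Set.ncard_union_eq _ (hfin.image _) (Set.toFinite _), Set.ncard_image_of_injective,
    Set.ncard_image_of_injective, Set.ncard_univ, Nat.card_fin]
  · change A.inDegree v + _ = 2
    omega
  · intro i j h
    injection h with h
    exact eq_of_heq (Sigma.mk.inj h).2
  · intro a b h
    simpa using h
  · rw [Set.disjoint_left]
    rintro _ ⟨α, -, rfl⟩ ⟨i, -, h⟩
    simp at h

theorem ncard_blossomS_eq_two (hA : A.IsLocallyGentle) (v : A.V) :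
    {e | A.blossomS e = .old v}.ncard = 2 := by
  have hfin : {α | A.s α = v}.Finite :=
    Set.finite_of_encard_le_coe (k := 2) (by exact_mod_cast hA.out_le v)
  have h3 : A.outDegree v ≤ 2 := by
    have := hA.out_le v
    rw [← hfin.cast_ncard_eq] at this
    exact_mod_cast this
  have h1 : {e | A.blossomS e = .old v} =
      BlossomE.old '' {α | A.s α = v} ∪
        (fun i : Fin (2 - A.outDegree v) => BlossomE.tau ⟨v, i⟩) '' Set.univ := by
    ext e
    constructor
    · intro h
      rcases e with α | x | ⟨w, i⟩
      · exact Or.inl ⟨α, by simpa [blossomS] using h, rfl⟩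
      · simp [blossomS] at h
      · obtain rfl : w = v := by simpa [blossomS] using h
        exact Or.inr ⟨i, trivial, rfl⟩
    · rintro (⟨α, rfl, rfl⟩ | ⟨i, -, rfl⟩) <;> rfl
  rw [h1, Set.ncard_union_eq _ (hfin.image _) (Set.toFinite _), Set.ncard_image_of_injective,
    Set.ncard_image_of_injective, Set.ncard_univ, Nat.card_fin]
  · change A.outDegree v + _ = 2
    omega
  · intro i j h
    injection h with h
    exact eq_of_heq (Sigma.mk.inj h).2
  · intro a b h
    simpa using h
  · rw [Set.disjoint_left]
    rintro _ ⟨α, -, rfl⟩ ⟨i, -, h⟩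
    simp at h

theorem exists_bit_of_compatible : ∀ p₁ p₂ q₁ q₂ a₁ a₂ b₁ b₂ : Bool, (p₁ → p₂ → a₁ ≠ a₂) →
    (q₁ → q₂ → b₁ ≠ b₂) → (p₁ → q₁ → a₁ = b₁) → (p₁ → q₂ → a₁ ≠ b₂) →
    (p₂ → q₁ → a₂ ≠ b₁) → (p₂ → q₂ → a₂ = b₂) →
    ∃ b : Bool, (p₁ → a₁ = b) ∧ (p₂ → a₂ = !b) ∧ (q₁ → b₁ = b) ∧ (q₂ → b₂ = !b) := by
  intro p₁ p₂ q₁ q₂ a₁ a₂ b₁ b₂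
  cases p₁ <;> cases p₂ <;> cases q₁ <;> cases q₂ <;> revert a₁ a₂ b₁ b₂ <;> simp

/-- A relation that is the graph of a bijection between two sets of two elements is the equality of
bits, and bits that are prescribed on parts of the two sets can be kept. -/
theorem exists_bits {X : Type*} {S T S₀ T₀ : Set X} {R : X → X → Prop} {f₀ g₀ : X → Bool}
    (hS : S.ncard = 2) (hT : T.ncard = 2)
    (hR : ∀ y ∈ T, ∀ x ∈ S, ∀ x' ∈ S, x ≠ x' → (R x y ↔ ¬ R x' y))
    (hR' : ∀ x ∈ S, ∀ y ∈ T, ∀ y' ∈ T, y ≠ y' → (R x y ↔ ¬ R x y'))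
    (hf : (S ∩ S₀).InjOn f₀) (hg : (T ∩ T₀).InjOn g₀)
    (hfg : ∀ x ∈ S ∩ S₀, ∀ y ∈ T ∩ T₀, (R x y ↔ f₀ x = g₀ y)) :
    ∃ f g : X → Bool, (∀ x ∈ S ∩ S₀, f x = f₀ x) ∧ (∀ y ∈ T ∩ T₀, g y = g₀ y) ∧
      S.InjOn f ∧ T.InjOn g ∧ ∀ x ∈ S, ∀ y ∈ T, (R x y ↔ f x = g y) := by
  classical
  obtain ⟨x₁, x₂, hx, rfl⟩ := Set.ncard_eq_two.1 hS
  -- The elements of `T` are named so that `x₁` corresponds to `y₁`.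
  obtain ⟨y₁, y₂, hy, rfl, h11⟩ : ∃ y₁ y₂, y₁ ≠ y₂ ∧ T = {y₁, y₂} ∧ R x₁ y₁ := by
    obtain ⟨y₁, y₂, hy, rfl⟩ := Set.ncard_eq_two.1 hT
    by_cases h : R x₁ y₁
    · exact ⟨y₁, y₂, hy, rfl, h⟩
    · refine ⟨y₂, y₁, hy.symm, Set.pair_comm _ _, ?_⟩
      exact (hR' x₁ (by simp) y₂ (by simp) y₁ (by simp) hy.symm).2 h
  have h21 : ¬ R x₂ y₁ := (hR y₁ (by simp) x₁ (by simp) x₂ (by simp) hx).1 h11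
  have h12 : ¬ R x₁ y₂ := (hR' x₁ (by simp) y₁ (by simp) y₂ (by simp) hy).1 h11
  have h22 : R x₂ y₂ := (hR' x₂ (by simp) y₂ (by simp) y₁ (by simp) hy.symm).2 h21
  obtain ⟨b, hb₁, hb₂, hb₃, hb₄⟩ : ∃ b : Bool, (x₁ ∈ S₀ → f₀ x₁ = b) ∧ (x₂ ∈ S₀ → f₀ x₂ = !b) ∧
      (y₁ ∈ T₀ → g₀ y₁ = b) ∧ (y₂ ∈ T₀ → g₀ y₂ = !b) := by
    have e1 : x₁ ∈ S₀ → x₂ ∈ S₀ → f₀ x₁ ≠ f₀ x₂ := fun h h' h'' =>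
      hx (hf ⟨by simp, h⟩ ⟨by simp, h'⟩ h'')
    have e2 : y₁ ∈ T₀ → y₂ ∈ T₀ → g₀ y₁ ≠ g₀ y₂ := fun h h' h'' =>
      hy (hg ⟨by simp, h⟩ ⟨by simp, h'⟩ h'')
    have e3 : x₁ ∈ S₀ → y₁ ∈ T₀ → f₀ x₁ = g₀ y₁ := fun h h' =>
      (hfg _ ⟨by simp, h⟩ _ ⟨by simp, h'⟩).1 h11
    have e4 : x₁ ∈ S₀ → y₂ ∈ T₀ → f₀ x₁ ≠ g₀ y₂ := fun h h' h'' =>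
      h12 ((hfg _ ⟨by simp, h⟩ _ ⟨by simp, h'⟩).2 h'')
    have e5 : x₂ ∈ S₀ → y₁ ∈ T₀ → f₀ x₂ ≠ g₀ y₁ := fun h h' h'' =>
      h21 ((hfg _ ⟨by simp, h⟩ _ ⟨by simp, h'⟩).2 h'')
    have e6 : x₂ ∈ S₀ → y₂ ∈ T₀ → f₀ x₂ = g₀ y₂ := fun h h' =>
      (hfg _ ⟨by simp, h⟩ _ ⟨by simp, h'⟩).1 h22
    have := exists_bit_of_compatible (decide (x₁ ∈ S₀)) (decide (x₂ ∈ S₀))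
      (decide (y₁ ∈ T₀)) (decide (y₂ ∈ T₀)) (f₀ x₁) (f₀ x₂) (g₀ y₁) (g₀ y₂)
    simp only [decide_eq_true_eq] at this
    exact this e1 e2 e3 e4 e5 e6
  refine ⟨fun x => if x = x₁ then b else !b, fun y => if y = y₁ then b else !b, ?_, ?_, ?_, ?_, ?_⟩
  · rintro x ⟨rfl | rfl, h⟩ <;> simp [hx.symm, *]
  · rintro y ⟨rfl | rfl, h⟩ <;> simp [hy.symm, *]
  · rintro x (rfl | rfl) x' (rfl | rfl) <;> simp [hx.symm]
  · rintro x (rfl | rfl) x' (rfl | rfl) <;> simp [hy.symm]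
  · rintro x (rfl | rfl) y (rfl | rfl) <;> simp [hx.symm, hy.symm, *]

/-- Bits `f₀` and `g₀` that are prescribed on a set `U` of arrows, and are compatible there, extend
to an assignment of slots for the blossoming. -/
theorem exists_blossomSlots (hA : A.IsLocallyGentle) (U : Set A.E) (f₀ g₀ : A.E → Bool)
    (hf : ∀ α ∈ U, ∀ β ∈ U, A.t α = A.t β → f₀ α = f₀ β → α = β)
    (hg : ∀ α ∈ U, ∀ β ∈ U, A.s α = A.s β → g₀ α = g₀ β → α = β)
    (hfg : ∀ α ∈ U, ∀ β ∈ U, A.t α = A.s β → (A.rel α β ↔ f₀ α = g₀ β)) :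
    ∃ c : A.BlossomSlots hA,
      ∀ α ∈ U, c.inn α = (A.t α, f₀ α) ∧ c.out α = (A.s α, g₀ α) := by
  have hB := A.blossom_isLocallyGentle hA
  have key := fun v : A.V => exists_bits (S := {e | A.blossomT e = .old v})
    (T := {e | A.blossomS e = .old v}) (S₀ := BlossomE.old '' U) (T₀ := BlossomE.old '' U)
    (R := A.blossomRel hA)
    (f₀ := fun e => match e with | .old α => f₀ α | _ => true)
    (g₀ := fun e => match e with | .old α => g₀ α | _ => true)
    (ncard_blossomT_eq_two hA v) (ncard_blossomS_eq_two hA v)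
    (by
      intro y hy x hx x' hx' hne
      have h1 := Set.encard_le_one_iff.1 (hB.rel_left y) x x'
      have h2 := Set.encard_le_one_iff.1 (hB.nrel_left y) x x'
      have h3 : A.blossomT x = A.blossomS y := hx.trans hy.symm
      have h4 : A.blossomT x' = A.blossomS y := hx'.trans hy.symm
      simp only [Set.mem_ofPred_eq, h3, h4, true_and] at h1 h2
      tauto)
    (by
      intro x hx y hy y' hy' hne
      have h1 := Set.encard_le_one_iff.1 (hB.rel_right x) y y'
      have h2 := Set.encard_le_one_iff.1 (hB.nrel_right x) y y'
      have h3 : A.blossomS y = A.blossomT x := hy.trans hx.symm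
      have h4 : A.blossomS y' = A.blossomT x := hy'.trans hx.symm
      simp only [Set.mem_ofPred_eq, h3, h4, true_and] at h1 h2
      tauto)
    (by
      rintro _ ⟨h1, α, hα, rfl⟩ _ ⟨h2, β, hβ, rfl⟩ h
      exact congrArg _ (hf α hα β hβ (by simpa [blossomT] using h1.trans h2.symm) h))
    (by
      rintro _ ⟨h1, α, hα, rfl⟩ _ ⟨h2, β, hβ, rfl⟩ h
      exact congrArg _ (hg α hα β hβ (by simpa [blossomS] using h1.trans h2.symm) h))
    (by
      rintro _ ⟨h1, α, hα, rfl⟩ _ ⟨h2, β, hβ, rfl⟩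
      exact ((A.isBlossomRel_blossomRel hA).extends_rel α β).trans
        (hfg α hα β hβ (by simpa [blossomS, blossomT] using h1.trans h2.symm)))
  choose f g hff hgg hfi hgi hfgR using key
  have hin : ∀ x v b, BlossomE.slotIn (fun α => (A.t α, f (A.t α) (.old α)))
      (fun x => (x.1, f x.1 (.sig x))) x = some (v, b) ↔ A.blossomT x = .old v ∧ f v x = b := by
    rintro (α | x | y) v b
    · simp only [BlossomE.slotIn, blossomT, Option.some.injEq, Prod.mk.injEq, BlossomV.old.injEq]
      exact and_congr_right fun h => by rw [h]
    · simp only [BlossomE.slotIn, blossomT, Option.some.injEq, Prod.mk.injEq, BlossomV.old.injEq]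
      exact and_congr_right fun h => by rw [h]
    · simp [BlossomE.slotIn, blossomT]
  have hout : ∀ x v b, BlossomE.slotOut (fun α => (A.s α, g (A.s α) (.old α)))
      (fun x => (x.1, g x.1 (.tau x))) x = some (v, b) ↔ A.blossomS x = .old v ∧ g v x = b := by
    rintro (α | x | y) v b
    · simp only [BlossomE.slotOut, blossomS, Option.some.injEq, Prod.mk.injEq, BlossomV.old.injEq]
      exact and_congr_right fun h => by rw [h]
    · simp [BlossomE.slotOut, blossomS]
    · simp only [BlossomE.slotOut, blossomS, Option.some.injEq, Prod.mk.injEq, BlossomV.old.injEq]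
      exact and_congr_right fun h => by rw [h]
  have hsurj : ∀ (S : Set A.BlossomE) (F : A.BlossomE → Bool), S.ncard = 2 → S.InjOn F →
      ∀ b, ∃! x, x ∈ S ∧ F x = b := by
    intro S F hS hF b
    obtain ⟨x₁, x₂, hx, rfl⟩ := Set.ncard_eq_two.1 hS
    have hne : F x₁ ≠ F x₂ := fun h => hx (hF (by simp) (by simp) h)
    refine existsUnique_of_exists_of_unique ?_ fun x y h1 h2 => hF h1.1 h2.1 (h1.2.trans h2.2.symm)
    by_cases h1 : F x₁ = b
    · exact ⟨x₁, by simp, h1⟩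
    · refine ⟨x₂, by simp, ?_⟩
      revert hne h1
      cases F x₁ <;> cases F x₂ <;> cases b <;> simp
  refine ⟨{
    inn := fun α => (A.t α, f (A.t α) (.old α))
    out := fun α => (A.s α, g (A.s α) (.old α))
    sig := fun x => (x.1, f x.1 (.sig x))
    tau := fun y => (y.1, g y.1 (.tau y))
    inn_fst := fun _ => rfl
    out_fst := fun _ => rfl
    sig_fst := fun _ => rfl
    tau_fst := fun _ => rfl
    in_unique := fun ⟨v, b⟩ => by
      simp only [hin]
      exact hsurj _ _ (ncard_blossomT_eq_two hA v) (hfi v) b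
    out_unique := fun ⟨v, b⟩ => by
      simp only [hout]
      exact hsurj _ _ (ncard_blossomS_eq_two hA v) (hgi v) b
    rel_iff := ?_ }, ?_⟩
  · intro x y
    constructor
    · intro h
      have h1 := A.blossomRel_comp hA x y h
      obtain ⟨v, hv⟩ : ∃ v, A.blossomT x = .old v := by
        rcases x with α | x | z
        · exact ⟨_, rfl⟩
        · exact ⟨_, rfl⟩
        · rcases y with β | y | y <;> simp [blossomT, blossomS] at h1
      have hv' : A.blossomS y = .old v := h1.symm.trans hv
      exact ⟨(v, f v x), (hin _ _ _).2 ⟨hv, rfl⟩,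
        (hout _ _ _).2 ⟨hv', ((hfgR v x hv y hv').1 h).symm⟩⟩
    · rintro ⟨⟨v, b⟩, h1, h2⟩
      obtain ⟨h1, h3⟩ := (hin _ _ _).1 h1
      obtain ⟨h2, h4⟩ := (hout _ _ _).1 h2
      exact (hfgR v x h1 y h2).2 (h3.trans h4.symm)
  · intro α hα
    exact ⟨Prod.ext rfl (hff _ _ ⟨rfl, α, hα, rfl⟩), Prod.ext rfl (hgg _ _ ⟨rfl, α, hα, rfl⟩)⟩

theorem nonempty_blossomSlots (hA : A.IsLocallyGentle) : Nonempty (A.BlossomSlots hA) := by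
  obtain ⟨c, -⟩ := exists_blossomSlots hA ∅ (fun _ => true) (fun _ => true)
    (by simp) (by simp) (by simp)
  exact ⟨c⟩

/-- Every assignment of slots for `A` extends to the blossoming. -/
theorem Slots.exists_extension (c : A.Slots) (hA : A.IsLocallyGentle) :
    ∃ c' : A.BlossomSlots hA, c'.inn = c.inn ∧ c'.out = c.out := by
  obtain ⟨c', hc'⟩ := exists_blossomSlots hA Set.univ (fun α => (c.inn α).2) (fun α => (c.out α).2)
    (fun α _ β _ h h' => c.inn_inj (Prod.ext (by rw [c.inn_fst, c.inn_fst, h]) h'))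
    (fun α _ β _ h h' => c.out_inj (Prod.ext (by rw [c.out_fst, c.out_fst, h]) h'))
    (fun α _ β _ h => by
      rw [c.rel_iff, Prod.ext_iff, c.inn_fst, c.out_fst]
      exact and_iff_right h)
  refine ⟨c', funext fun α => ?_, funext fun α => ?_⟩
  · rw [(hc' α trivial).1, ← c.inn_fst]
  · rw [(hc' α trivial).2, ← c.out_fst]

end BoundQuiver

/-! ### Maximal words -/

theorem isMaximalWord_iff {X : Type u} {r : X → X → Prop} {w : List X} :
    IsMaximalWord r w ↔ ∃ a b, w.head? = some a ∧ w.getLast? = some b ∧ w.IsChain r ∧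
      (∀ x, ¬ r x a) ∧ ∀ y, ¬ r b y := by
  constructor
  · rintro ⟨h1, h2, h3, h4⟩
    have ha := List.head?_eq_some_head h1
    have hb := List.getLast?_eq_some_getLast h1
    refine ⟨_, _, ha, hb, h2, fun x hx => h3 x ?_, fun y hy => h4 y ?_⟩
    · rw [List.isChain_cons]
      exact ⟨by simpa [ha] using hx, h2⟩
    · rw [List.isChain_append]
      exact ⟨h2, by simp, by simpa [hb] using hy⟩
  · rintro ⟨a, b, ha, hb, h, h1, h2⟩
    refine ⟨fun hw => by simp [hw] at ha, h, fun x hx => h1 x ?_, fun y hy => h2 y ?_⟩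
    · rw [List.isChain_cons] at hx
      exact hx.1 a (by simp [ha])
    · rw [List.isChain_append] at hy
      exact hy.2.2 b (by simp [hb]) y (by simp)

/-- In a finite set, the path of an element without predecessor ends, as it cannot be closed up. -/
theorem exists_reflTransGen_terminal {X : Type*} [Finite X] {r : X → X → Prop}
    (hr : ∀ x y z, r x z → r y z → x = y) {x : X} (hx : ∀ y, ¬ r y x) :
    ∃ z, Relation.ReflTransGen r x z ∧ ∀ w, ¬ r z w := by
  by_contra! h
  choose! f hf using h
  let g : {z // Relation.ReflTransGen r x z} → {z // Relation.ReflTransGen r x z} :=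
    fun z => ⟨f z.1, z.2.tail (hf z.1 z.2)⟩
  have hg : g.Injective := fun z w h => by
    have h1 := hf z.1 z.2
    rw [show f z.1 = f w.1 from congrArg Subtype.val h] at h1
    exact Subtype.ext (hr _ _ _ h1 (hf w.1 w.2))
  obtain ⟨z, hz⟩ := Finite.surjective_of_injective hg ⟨x, .refl⟩
  have h1 := hf z.1 z.2
  rw [show f z.1 = x from congrArg Subtype.val hz] at h1
  exact hx _ h1

theorem exists_isMaximalWord_iff {X : Type u} {r : X → X → Prop} {a b : X}
    (ha : ∀ x, ¬ r x a) (hb : ∀ y, ¬ r b y) :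
    (∃ w, IsMaximalWord r w ∧ w.head? = some a ∧ w.getLast? = some b) ↔
      Relation.ReflTransGen r a b := by
  constructor
  · rintro ⟨w, hw, h1, h2⟩
    have h := List.relationReflTransGen_of_exists_isChain w hw.chain hw.ne_nil
    rw [List.head?_eq_some_head hw.ne_nil, Option.some.injEq] at h1
    rw [List.getLast?_eq_some_getLast hw.ne_nil, Option.some.injEq] at h2
    rwa [h1, h2] at h
  · intro h
    obtain ⟨w, hw, h1, h2, h3⟩ := List.exists_isChain_ne_nil_of_relationReflTransGen h
    have h4 : w.head? = some a := by rw [List.head?_eq_some_head hw, h2]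
    have h5 : w.getLast? = some b := by rw [List.getLast?_eq_some_getLast hw, h3]
    exact ⟨w, isMaximalWord_iff.2 ⟨a, b, h4, h5, h1, ha, hb⟩, h4, h5⟩

namespace BoundQuiver

variable {A : BoundQuiver.{u}} {hA : A.IsLocallyGentle}

instance [Finite A.V] : Finite A.SourceBlossom :=
  inferInstanceAs (Finite (Σ v : A.V, Fin (2 - A.inDegree v)))

instance [Finite A.V] : Finite A.SinkBlossom :=
  inferInstanceAs (Finite (Σ v : A.V, Fin (2 - A.outDegree v)))

instance [Finite A.V] [Finite A.E] : Finite A.BlossomE := by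
  refine Finite.of_surjective
    (fun x : A.E ⊕ A.SourceBlossom ⊕ A.SinkBlossom =>
      x.elim BlossomE.old (Sum.elim BlossomE.sig BlossomE.tau)) ?_
  rintro (α | x | y)
  · exact ⟨.inl α, rfl⟩
  · exact ⟨.inr (.inl x), rfl⟩
  · exact ⟨.inr (.inr y), rfl⟩

namespace BlossomSlots

variable (c : A.BlossomSlots hA)

/-! ### Labels in terms of slots -/

/-- The slot which an arrow of the blossoming enters, if any. -/
abbrev inSlot : A.BlossomE → Option A.Slot := BlossomE.slotIn c.inn c.sig

/-- The slot which an arrow of the blossoming leaves, if any. -/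
abbrev outSlot : A.BlossomE → Option A.Slot := BlossomE.slotOut c.out c.tau

theorem inSlot_inj {x y : A.BlossomE} {h : A.Slot} (hx : c.inSlot x = some h)
    (hy : c.inSlot y = some h) : x = y :=
  (c.in_unique h).unique hx hy

theorem outSlot_inj {x y : A.BlossomE} {h : A.Slot} (hx : c.outSlot x = some h)
    (hy : c.outSlot y = some h) : x = y :=
  (c.out_unique h).unique hx hy

theorem out_injective : c.out.Injective := fun α β h => by
  simpa using c.outSlot_inj (x := .old α) (y := .old β) rfl (congrArg some h.symm)

theorem sig_injective : c.sig.Injective := fun α β h => by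
  simpa using c.inSlot_inj (x := .sig α) (y := .sig β) rfl (congrArg some h.symm)

theorem tau_injective : c.tau.Injective := fun α β h => by
  simpa using c.outSlot_inj (x := .tau α) (y := .tau β) rfl (congrArg some h.symm)

theorem inn_ne_sig (α : A.E) (x : A.SourceBlossom) : c.inn α ≠ c.sig x := fun h => by
  simpa using c.inSlot_inj (x := .old α) (y := .sig x) rfl (congrArg some h.symm)

theorem out_ne_tau (α : A.E) (y : A.SinkBlossom) : c.out α ≠ c.tau y := fun h => by
  simpa using c.outSlot_inj (x := .old α) (y := .tau y) rfl (congrArg some h.symm)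

theorem inn_or_sig (h : A.Slot) : (∃ α, c.inn α = h) ∨ ∃ x, c.sig x = h := by
  obtain ⟨α | x | y, hx, -⟩ := c.in_unique h
  · exact .inl ⟨α, Option.some.inj hx⟩
  · exact .inr ⟨x, Option.some.inj hx⟩
  · simp [BlossomE.slotIn] at hx

theorem out_or_tau (h : A.Slot) : (∃ α, c.out α = h) ∨ ∃ y, c.tau y = h := by
  obtain ⟨α | x | y, hx, -⟩ := c.out_unique h
  · exact .inl ⟨α, Option.some.inj hx⟩
  · simp [BlossomE.slotOut] at hx
  · exact .inr ⟨y, Option.some.inj hx⟩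

theorem blossomT_eq {x : A.BlossomE} {h : A.Slot} (hx : c.inSlot x = some h) :
    A.blossomT x = .old h.1 := by
  rcases x with α | x | y
  · obtain rfl := Option.some.inj hx
    exact congrArg _ (c.inn_fst α).symm
  · obtain rfl := Option.some.inj hx
    exact congrArg _ (c.sig_fst x).symm
  · simp [BlossomE.slotIn] at hx

theorem blossomS_eq {x : A.BlossomE} {h : A.Slot} (hx : c.outSlot x = some h) :
    A.blossomS x = .old h.1 := by
  rcases x with α | x | y
  · obtain rfl := Option.some.inj hx
    exact congrArg _ (c.out_fst α).symm
  · simp [BlossomE.slotOut] at hx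
  · obtain rfl := Option.some.inj hx
    exact congrArg _ (c.tau_fst y).symm

theorem permitted_iff {x y : A.BlossomE} : (A.blossom hA).Permitted x y ↔
    ∃ h, c.inSlot x = some h ∧ c.outSlot y = some (Slot.flip h) := by
  constructor
  · rintro ⟨h1, h2⟩
    change A.blossomT x = A.blossomS y at h1
    obtain ⟨g, hg⟩ : ∃ g, c.inSlot x = some g := by
      rcases x with α | x | z
      · exact ⟨_, rfl⟩
      · exact ⟨_, rfl⟩
      · rcases y with β | y | y <;> simp [blossomT, blossomS] at h1
    obtain ⟨h, hh⟩ : ∃ h, c.outSlot y = some h := by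
      rcases y with α | y | z
      · exact ⟨_, rfl⟩
      · rcases x with β | x | x <;> simp [blossomT, blossomS] at h1
      · exact ⟨_, rfl⟩
    refine ⟨g, hg, hh.trans (congrArg _ (Slot.eq_flip_iff.2 ⟨?_, ?_⟩))⟩
    · rw [c.blossomT_eq hg, c.blossomS_eq hh] at h1
      exact (BlossomV.old.inj h1).symm
    · rintro rfl
      exact h2 ((c.rel_iff x y).2 ⟨_, hg, hh⟩)
  · rintro ⟨h, h1, h2⟩
    refine ⟨?_, fun h3 => ?_⟩
    · exact (c.blossomT_eq h1).trans (c.blossomS_eq h2).symm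
    · obtain ⟨g, h4, h5⟩ := (c.rel_iff x y).1 h3
      obtain rfl := Option.some.inj (h1.symm.trans h4)
      exact (Slot.eq_flip_iff.1 (Option.some.inj (h5.symm.trans h2))).2 rfl

/-- Two slots are consecutive on a path of `A`: an arrow of `A` that enters the second leaves the
slot opposite to the first. -/
def PathStep (g h : A.Slot) : Prop := ∃ α, c.out α = Slot.flip g ∧ c.inn α = h

theorem exists_label_iff_permitted {x : A.SourceBlossom} {y : A.SinkBlossom} :
    (∃ p : A.Label hA, p.src = x ∧ p.snk = y) ↔
      Relation.ReflTransGen (A.blossom hA).Permitted (.sig x) (.tau y) := by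
  rw [← exists_isMaximalWord_iff]
  · constructor
    · rintro ⟨p, rfl, rfl⟩
      exact p.connected
    · exact fun h => ⟨⟨x, y, h⟩, rfl, rfl⟩
  · obtain ⟨c⟩ := nonempty_blossomSlots hA
    intro z hz
    obtain ⟨h, -, h2⟩ := c.permitted_iff.1 hz
    simp [BlossomE.slotOut] at h2
  · obtain ⟨c⟩ := nonempty_blossomSlots hA
    intro z hz
    obtain ⟨h, h1, -⟩ := c.permitted_iff.1 hz
    simp [BlossomE.slotIn] at h1

/-- A path from `σ_p` to `τ_p` enters the slot of `σ_p` first, and it leaves that of `τ_p` last, so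
that the slot which it enters before is the opposite one. -/
theorem exists_label_iff {x : A.SourceBlossom} {y : A.SinkBlossom} :
    (∃ p : A.Label hA, p.src = x ∧ p.snk = y) ↔
      Relation.ReflTransGen c.PathStep (c.sig x) (Slot.flip (c.tau y)) := by
  rw [exists_label_iff_permitted]
  constructor
  · intro h
    have key : ∀ z, Relation.ReflTransGen (A.blossom hA).Permitted (.sig x) z →
        z = .sig x ∨ ∃ h, c.outSlot z = some h ∧
          Relation.ReflTransGen c.PathStep (c.sig x) (Slot.flip h) := by
      intro z hz
      induction hz with
      | refl => exact .inl rfl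
      | @tail z w hz hw ih =>
        obtain ⟨g, h1, h2⟩ := c.permitted_iff.1 hw
        refine .inr ⟨_, h2, ?_⟩
        rw [Slot.flip_flip]
        rcases ih with rfl | ⟨h, h3, h4⟩
        · obtain rfl := Option.some.inj h1
          exact .refl
        · rcases z with α | z | z
          · refine h4.tail ⟨α, ?_, Option.some.inj h1⟩
            rw [Slot.flip_flip]
            exact Option.some.inj h3
          · simp [BlossomE.slotOut] at h3
          · simp [BlossomE.slotIn] at h1
    rcases key _ h with h1 | ⟨g, h1, h2⟩
    · simp at h1
    · obtain rfl := Option.some.inj h1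
      exact h2
  · intro h
    have key : ∀ g, Relation.ReflTransGen c.PathStep (c.sig x) g →
        ∃ z, c.inSlot z = some g ∧
          Relation.ReflTransGen (A.blossom hA).Permitted (.sig x) z := by
      intro g hg
      induction hg with
      | refl => exact ⟨_, rfl, .refl⟩
      | @tail g g' _ hg' ih =>
        obtain ⟨z, h1, h2⟩ := ih
        obtain ⟨α, h3, rfl⟩ := hg'
        exact ⟨.old α, rfl, h2.tail (c.permitted_iff.2 ⟨g, h1, congrArg some h3⟩)⟩
    obtain ⟨z, h1, h2⟩ := key _ h
    refine h2.tail (c.permitted_iff.2 ⟨_, h1, ?_⟩)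
    rw [Slot.flip_flip]
    rfl

theorem exists_label_src [Finite A.V] [Finite A.E] (x : A.SourceBlossom) :
    ∃ p : A.Label hA, p.src = x := by
  obtain ⟨c⟩ := nonempty_blossomSlots hA
  obtain ⟨z, h1, h2⟩ := exists_reflTransGen_terminal (r := (A.blossom hA).Permitted)
    (x := .sig x)
    (fun x y z hx hy => by
      obtain ⟨g, h1, h2⟩ := c.permitted_iff.1 hx
      obtain ⟨h, h3, h4⟩ := c.permitted_iff.1 hy
      obtain rfl : g = h := by
        rw [h2, Option.some.injEq] at h4
        simpa using congrArg Slot.flip h4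
      exact c.inSlot_inj h1 h3)
    (fun y hy => by
      obtain ⟨h, -, h2⟩ := c.permitted_iff.1 hy
      simp [BlossomE.slotOut] at h2)
  have key : ∀ g, c.inSlot z ≠ some g := fun g hg => by
    obtain ⟨w, hw, -⟩ := c.out_unique (Slot.flip g)
    exact h2 w (c.permitted_iff.2 ⟨g, hg, hw⟩)
  rcases z with α | z | z
  · exact absurd rfl (key _)
  · exact absurd rfl (key _)
  · obtain ⟨p, hp, -⟩ := exists_label_iff_permitted.2 h1
    exact ⟨p, hp⟩

theorem exists_label_snk [Finite A.V] [Finite A.E] (y : A.SinkBlossom) :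
    ∃ p : A.Label hA, p.snk = y := by
  obtain ⟨c⟩ := nonempty_blossomSlots hA
  obtain ⟨z, h1, h2⟩ := exists_reflTransGen_terminal
    (r := Function.swap (A.blossom hA).Permitted) (x := .tau y)
    (fun x y z hx hy => by
      obtain ⟨g, h1, h2⟩ := c.permitted_iff.1 hx
      obtain ⟨h, h3, h4⟩ := c.permitted_iff.1 hy
      obtain rfl : g = h := by
        rw [h1, Option.some.injEq] at h3
        exact h3
      exact c.outSlot_inj h2 h4)
    (fun y hy => by
      obtain ⟨h, h1, -⟩ := c.permitted_iff.1 hy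
      simp [BlossomE.slotIn] at h1)
  have key : ∀ g, c.outSlot z ≠ some g := fun g hg => by
    obtain ⟨w, hw, -⟩ := c.in_unique (Slot.flip g)
    exact h2 w (c.permitted_iff.2 ⟨Slot.flip g, hw, by rw [Slot.flip_flip]; exact hg⟩)
  rw [Relation.reflTransGen_swap] at h1
  rcases z with α | z | z
  · exact absurd rfl (key _)
  · obtain ⟨p, -, hp⟩ := exists_label_iff_permitted.2 h1
    exact ⟨p, hp⟩
  · exact absurd rfl (key _)

/-! ### The permutation of the slots -/

theorem exists_next [Finite A.V] [Finite A.E] : ∃ P : A.Slot → A.Slot,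
    (∀ α, P (c.out α) = c.inn α) ∧ ∀ p : A.Label hA, P (c.tau p.snk) = c.sig p.src := by
  have key : ∀ h, ∃ h', (∀ α, c.out α = h → c.inn α = h') ∧
      ∀ p : A.Label hA, c.tau p.snk = h → c.sig p.src = h' := by
    intro h
    rcases c.out_or_tau h with ⟨α, rfl⟩ | ⟨y, rfl⟩
    · exact ⟨c.inn α, fun β hβ => by rw [c.out_injective hβ],
        fun p hp => absurd hp.symm (c.out_ne_tau _ _)⟩
    · obtain ⟨p, rfl⟩ := exists_label_snk (hA := hA) y
      exact ⟨c.sig p.src, fun β hβ => absurd hβ (c.out_ne_tau _ _),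
        fun p' hp' => by rw [Label.ext_snk (c.tau_injective hp')]⟩
  choose P hP using key
  exact ⟨P, fun α => ((hP _).1 α rfl).symm, fun p => ((hP _).2 p rfl).symm⟩

/-- The slots left by the arrows `τ_p`. -/
def terminal : Set A.Slot := Set.range c.tau

theorem out_notMem_terminal (α : A.E) : c.out α ∉ c.terminal :=
  fun ⟨y, hy⟩ => c.out_ne_tau α y hy.symm

variable [Finite A.V] [Finite A.E]

/-- The permutation of the slots that takes the slot left by an arrow of `A` to the slot which this
arrow enters, and the slot left by `τ_p` to the slot entered by `σ_p`. -/
noncomputable def next : A.Slot → A.Slot := c.exists_next.choose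

@[simp]
theorem next_out (α : A.E) : c.next (c.out α) = c.inn α := c.exists_next.choose_spec.1 α

@[simp]
theorem next_tau (p : A.Label hA) : c.next (c.tau p.snk) = c.sig p.src :=
  c.exists_next.choose_spec.2 p

theorem next_injective : c.next.Injective := by
  rw [Finite.injective_iff_surjective]
  intro h
  rcases c.inn_or_sig h with ⟨α, rfl⟩ | ⟨x, rfl⟩
  · exact ⟨_, c.next_out α⟩
  · obtain ⟨p, rfl⟩ := exists_label_src (hA := hA) x
    exact ⟨_, c.next_tau p⟩

end BlossomSlots

end BoundQuiver

section cycles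

open Function

/-! ### Cycles and threads of an injective self-map -/

/-- The cycles of `P` that meet `T` are cut behind the elements of `T` into threads: the thread `D`
consists of the `len D + 1` elements `first D, P (first D), …, last D`, of which only `last D` is in
`T`, and `step D D'` means that `D'` is the thread before `D`. -/
structure IsThreading {H I : Type*} (P : H → H) (T : Set H) (first last : I → H) (len : I → ℕ)
    (step : I → I → Prop) : Prop where
  last_injective : last.Injective
  range_last : Set.range last = T
  iterate_first : ∀ D, P^[len D] (first D) = last D
  notMem : ∀ D, ∀ j < len D, P^[j] (first D) ∉ T
  exists_first : ∀ D, ∃ t ∈ T, P t = first D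
  step_iff : ∀ D D', step D D' ↔ P (last D') = first D

theorem IsThreading.last_mem {H I : Type*} {P : H → H} {T : Set H} {first last : I → H}
    {len : I → ℕ} {step : I → I → Prop} (ht : IsThreading P T first last len step) (D : I) :
    last D ∈ T :=
  ht.range_last ▸ Set.mem_range_self D

variable {H : Type*} [Finite H] {P : H → H}

theorem setOf_iterate_eq_image (hP : P.Injective) (h : H) :
    {h' | ∃ j, P^[j] h = h'} = (fun j => P^[j] h) '' Set.Iio (minimalPeriod P h) := by
  ext h'
  constructor
  · rintro ⟨j, rfl⟩
    exact ⟨j % minimalPeriod P h,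
      Nat.mod_lt _ (minimalPeriod_pos_of_mem_periodicPts (hP.mem_periodicPts h)),
      iterate_mod_minimalPeriod_eq⟩
  · rintro ⟨j, -, rfl⟩
    exact ⟨j, rfl⟩

theorem ncard_setOf_iterate_eq (hP : P.Injective) (h : H) :
    {h' | ∃ j, P^[j] h = h'}.ncard = minimalPeriod P h := by
  rw [setOf_iterate_eq_image hP, iterate_injOn_Iio_minimalPeriod.ncard_image,
    ← Finset.coe_Iio, Set.ncard_coe_finset, Nat.card_Iio]

theorem ncard_setOf_iterate_eq_inter (hP : P.Injective) (T : Set H) (h : H) :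
    {h' | h' ∈ T ∧ ∃ j, P^[j] h = h'}.ncard = cycleVisits P T h := by
  classical
  have h1 : {h' | h' ∈ T ∧ ∃ j, P^[j] h = h'} = (fun j => P^[j] h) ''
      ↑((Finset.range (minimalPeriod P h)).filter fun j => P^[j] h ∈ T) := by
    ext h'
    have h2 := Set.ext_iff.1 (setOf_iterate_eq_image hP h) h'
    simp only [Set.mem_ofPred_eq] at h2
    rw [Set.mem_ofPred_eq, h2]
    simp only [Set.mem_image, Finset.coe_filter, Finset.mem_range, Set.mem_ofPred_eq, Set.mem_Iio]
    constructor
    · rintro ⟨h3, j, h4, rfl⟩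
      exact ⟨j, ⟨h4, h3⟩, rfl⟩
    · rintro ⟨j, ⟨h4, h3⟩, rfl⟩
      exact ⟨h3, j, h4, rfl⟩
  have h2 : Set.InjOn (fun j => P^[j] h)
      ↑((Finset.range (minimalPeriod P h)).filter fun j => P^[j] h ∈ T) := by
    refine iterate_injOn_Iio_minimalPeriod.mono fun j hj => ?_
    simp only [Finset.coe_filter, Finset.mem_range, Set.mem_ofPred_eq] at hj
    exact hj.1
  rw [h1, h2.ncard_image, Set.ncard_coe_finset, cycleVisits, visits,
    Nat.count_eq_card_filter_range]

theorem exists_iterate_eq_symm (hP : P.Injective) {h h' : H} (hh : ∃ j, P^[j] h = h') :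
    ∃ j, P^[j] h' = h := by
  obtain ⟨j, rfl⟩ := hh
  have hm := minimalPeriod_pos_of_mem_periodicPts (hP.mem_periodicPts h)
  refine ⟨j * minimalPeriod P h - j, ?_⟩
  rw [← iterate_add_apply, Nat.sub_add_cancel (Nat.le_mul_of_pos_right _ hm)]
  exact (isPeriodicPt_minimalPeriod P h).const_mul j

namespace IsThreading

variable {I : Type*} {T : Set H} {first last : I → H} {len : I → ℕ} {step : I → I → Prop}

theorem eqvGen_iff (ht : IsThreading P T first last len step) (hP : P.Injective) {D D' : I} :
    Relation.EqvGen step D D' ↔ ∃ j, P^[j] (last D) = last D' := by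
  constructor
  · intro h
    induction h with
    | rel D D' h =>
      refine exists_iterate_eq_symm hP ⟨len D + 1, ?_⟩
      rw [iterate_succ_apply, (ht.step_iff _ _).1 h, ht.iterate_first]
    | refl D => exact ⟨0, rfl⟩
    | symm D D' _ ih => exact exists_iterate_eq_symm hP ih
    | trans D D' D'' _ _ ih ih' =>
      obtain ⟨j, hj⟩ := ih
      obtain ⟨k, hk⟩ := ih'
      exact ⟨k + j, by rw [iterate_add_apply, hj, hk]⟩
  · rintro ⟨j, hj⟩
    induction j using Nat.strong_induction_on generalizing D' with
    | _ j ih =>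
      rcases Nat.eq_zero_or_pos j with rfl | hpos
      · rw [ht.last_injective hj]
        exact .refl _
      obtain ⟨t, h1, h2⟩ := ht.exists_first D'
      rw [← ht.range_last] at h1
      obtain ⟨D'', rfl⟩ := h1
      have h3 := ht.iterate_first D'
      rcases Nat.lt_or_ge (len D') j with h4 | h4
      · refine .trans _ _ _ (ih (j - (len D' + 1)) (by omega) ?_)
          (.symm _ _ (.rel _ _ ((ht.step_iff _ _).2 h2)))
        refine hP.iterate (len D' + 1) ?_
        rw [← iterate_add_apply, Nat.add_sub_cancel' h4, hj, iterate_succ_apply, h2, h3]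
      · refine absurd (ht.last_mem D) ?_
        have h5 : last D = P^[len D' - j] (first D') := by
          refine hP.iterate j ?_
          rw [hj, ← iterate_add_apply, Nat.add_sub_cancel' h4, h3]
        rw [h5]
        exact ht.notMem _ _ (by omega)

theorem ncard_orbit (ht : IsThreading P T first last len step) (hP : P.Injective) (D : I) :
    {D' | Relation.EqvGen step D D'}.ncard = cycleVisits P T (last D) := by
  rw [← Set.ncard_image_of_injective _ ht.last_injective, ← ncard_setOf_iterate_eq_inter hP]
  congr 1
  ext h
  constructor
  · rintro ⟨D', h1, rfl⟩
    exact ⟨ht.last_mem D', (ht.eqvGen_iff hP).1 h1⟩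
  · rintro ⟨h1, h2⟩
    rw [← ht.range_last] at h1
    obtain ⟨D', rfl⟩ := h1
    exact ⟨D', (ht.eqvGen_iff hP).2 h2, rfl⟩

/-- Every element `h` of a cycle that meets `T` lies in exactly one thread, namely the one which
ends where the orbit of `h` meets `T` for the first time. -/
theorem sum_len_add_one (ht : IsThreading P T first last len step) (hP : P.Injective) (D : I) :
    ∑ᶠ D' ∈ {D' | Relation.EqvGen step D D'}, (len D' + 1) = minimalPeriod P (last D) := by
  classical
  have : Finite I := Finite.of_injective _ ht.last_injective
  have := Fintype.ofFinite I
  have hfin := Set.toFinite {D' | Relation.EqvGen step D D'}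
  let b : I → Finset H := fun D => (Finset.range (len D + 1)).image fun j => P^[j] (first D)
  have hrest : ∀ D, ∀ j ≤ len D, P^[len D - j] (P^[j] (first D)) = last D := fun D j hj => by
    rw [← iterate_add_apply, Nat.sub_add_cancel hj, ht.iterate_first]
  -- An element of a thread determines its distance from the end of the thread.
  have huniq : ∀ D D' j j', j ≤ len D → j' ≤ len D' → P^[j] (first D) = P^[j'] (first D') →
      len D - j = len D' - j' := by
    have hle : ∀ D D' j j', j ≤ len D → j' ≤ len D' → P^[j] (first D) = P^[j'] (first D') →
        len D' - j' ≤ len D - j := by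
      intro D D' j j' hj hj' h
      by_contra! hlt
      have h1 := hrest D j hj
      rw [h, ← iterate_add_apply] at h1
      exact ht.notMem D' _ (by omega) (h1 ▸ ht.last_mem D)
    intro D D' j j' hj hj' h
    exact le_antisymm (hle _ _ _ _ hj' hj h.symm) (hle _ _ _ _ hj hj' h)
  have hcard : ∀ D, (b D).card = len D + 1 := by
    intro D
    rw [Finset.card_image_of_injOn, Finset.card_range]
    intro j hj j' hj' h
    simp only [Finset.coe_range, Set.mem_Iio] at hj hj'
    have := huniq D D j j' (by omega) (by omega) h
    omega
  have hdisj : ∀ D D', D ≠ D' → Disjoint (b D) (b D') := by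
    intro D D' hne
    rw [Finset.disjoint_left]
    intro h h1 h2
    simp only [b, Finset.mem_image, Finset.mem_range] at h1 h2
    obtain ⟨j, hj, rfl⟩ := h1
    obtain ⟨j', hj', h⟩ := h2
    apply hne
    apply ht.last_injective
    rw [← hrest D j (by omega), ← hrest D' j' (by omega), h,
      huniq D D' j j' (by omega) (by omega) h.symm]
  rw [finsum_mem_eq_finite_toFinset_sum _ hfin, ← Finset.sum_congr rfl fun D _ => hcard D,
    ← Finset.card_biUnion fun D _ D' _ h => hdisj D D' h, ← ncard_setOf_iterate_eq hP,
    ← Set.ncard_coe_finset]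
  congr 1
  ext h
  simp only [Finset.mem_coe, Finset.mem_biUnion, Set.Finite.mem_toFinset, Set.mem_ofPred_eq, b,
    Finset.mem_image, Finset.mem_range, ht.eqvGen_iff hP]
  constructor
  · rintro ⟨D', ⟨i, h1⟩, j, hj, rfl⟩
    obtain ⟨k, hk⟩ := exists_iterate_eq_symm hP ⟨_, hrest D' j (by omega)⟩
    exact ⟨k + i, by rw [iterate_add_apply, h1, hk]⟩
  · rintro ⟨i, hi⟩
    have hex : ∃ j, P^[j] h ∈ T := by
      obtain ⟨k, hk⟩ := exists_iterate_eq_symm hP ⟨i, hi⟩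
      exact ⟨k, hk ▸ ht.last_mem D⟩
    have h1 := Nat.find_spec hex
    have hmin := fun m => Nat.find_min hex (m := m)
    set j := Nat.find hex
    rw [← ht.range_last] at h1
    obtain ⟨D', h1⟩ := h1
    refine ⟨D', ⟨j + i, by rw [iterate_add_apply, hi, h1]⟩, len D' - j, by omega, ?_⟩
    have h2 := ht.iterate_first D'
    have hj : j ≤ len D' := by
      by_contra! hlt
      obtain ⟨t, h3, h4⟩ := ht.exists_first D'
      refine hmin (j - (len D' + 1)) (by omega) ?_
      have h5 : P^[j - (len D' + 1)] h = t := by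
        refine hP.iterate (len D' + 1) ?_
        rw [← iterate_add_apply, Nat.add_sub_cancel' hlt, ← h1, iterate_succ_apply, h4, h2]
      rwa [h5]
    refine hP.iterate j ?_
    rw [← iterate_add_apply, Nat.add_sub_cancel' hj, h2, h1]

/-- An orbit of `q` threads is counted by its `q` end points. -/
theorem mul_ncard_orbits (ht : IsThreading P T first last len step) (hP : P.Injective) (q l : ℕ) :
    q * {O : Set I | (∃ D, O = {D' | Relation.EqvGen step D D'}) ∧
        (O.ncard, ∑ᶠ D ∈ O, len D) = (q, l)}.ncard =
      {h | h ∈ T ∧ cycleVisits P T h = q ∧ minimalPeriod P h = q + l}.ncard := by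
  classical
  have : Finite I := Finite.of_injective _ ht.last_injective
  have := Fintype.ofFinite I
  let orb : I → Set I := fun D => {D' | Relation.EqvGen step D D'}
  have horb : ∀ D D', orb D' = orb D ↔ D' ∈ orb D := by
    intro D D'
    constructor
    · intro h
      rw [← h]
      exact .refl _
    · intro h
      ext D''
      exact ⟨fun h' => .trans _ _ _ h h', fun h' => .trans _ _ _ (.symm _ _ h) h'⟩
  have htype : ∀ D, ((orb D).ncard, ∑ᶠ D' ∈ orb D, len D') = (q, l) ↔
      cycleVisits P T (last D) = q ∧ minimalPeriod P (last D) = q + l := by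
    intro D
    rw [Prod.mk.injEq, ← ht.ncard_orbit hP, ← ht.sum_len_add_one hP,
      finsum_mem_add_distrib (Set.toFinite _),
      finsum_mem_eq_finite_toFinset_sum (fun _ => 1) (Set.toFinite _), Finset.sum_const,
      smul_eq_mul, mul_one, ← Set.ncard_eq_toFinset_card _ (Set.toFinite _)]
    refine and_congr_right fun h => ?_
    rw [show {D' | Relation.EqvGen step D D'}.ncard = q from h, add_comm, Nat.add_left_cancel_iff]
  have h1 : {h | h ∈ T ∧ cycleVisits P T h = q ∧ minimalPeriod P h = q + l} =
      last '' {D | ((orb D).ncard, ∑ᶠ D' ∈ orb D, len D') = (q, l)} := by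
    ext h
    constructor
    · rintro ⟨h2, h3⟩
      rw [← ht.range_last] at h2
      obtain ⟨D, rfl⟩ := h2
      exact ⟨D, (htype D).2 h3, rfl⟩
    · rintro ⟨D, hD, rfl⟩
      exact ⟨ht.last_mem D, (htype D).1 hD⟩
  rw [h1, Set.ncard_image_of_injective _ ht.last_injective, Set.ncard_eq_toFinset_card',
    Set.ncard_eq_toFinset_card', Finset.card_eq_sum_card_fiberwise (f := orb)
    (t := Set.toFinset {O : Set I | (∃ D, O = orb D) ∧ (O.ncard, ∑ᶠ D ∈ O, len D) = (q, l)})]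
  · rw [mul_comm, Finset.sum_const_nat]
    intro O hO
    rw [Set.mem_toFinset] at hO
    obtain ⟨⟨D, rfl⟩, hD⟩ := hO
    refine Eq.trans ?_ (Prod.mk.inj hD).1
    rw [Set.ncard_eq_toFinset_card']
    congr 1
    ext D'
    simp only [Finset.mem_filter, Set.mem_toFinset, horb]
    refine ⟨fun h => h.2, fun h => ⟨?_, h⟩⟩
    rw [Set.mem_ofPred_eq, (horb D D').2 h]
    exact hD
  · intro D hD
    rw [Set.coe_toFinset] at hD ⊢
    exact ⟨⟨D, rfl⟩, hD⟩

end IsThreading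

end cycles

namespace BoundQuiver

variable {A : BoundQuiver.{u}} {hA : A.IsLocallyGentle}

namespace BlossomSlots

variable (c : A.BlossomSlots hA)

/-! ### Maximal antipaths as threads -/

theorem not_rel_sig (x : A.SourceBlossom) (z : A.BlossomE) : ¬ A.blossomRel hA z (.sig x) := by
  obtain ⟨c⟩ := nonempty_blossomSlots hA
  rw [c.rel_iff]
  simp [BlossomE.slotOut]

theorem not_rel_tau (y : A.SinkBlossom) (z : A.BlossomE) : ¬ A.blossomRel hA (.tau y) z := by
  obtain ⟨c⟩ := nonempty_blossomSlots hA
  rw [c.rel_iff]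
  simp [BlossomE.slotIn]

theorem exists_eq_sig {z : A.BlossomE} (hz : ∀ x, ¬ A.blossomRel hA x z) : ∃ x, z = .sig x := by
  obtain ⟨c⟩ := nonempty_blossomSlots hA
  have key : ∀ g, c.outSlot z ≠ some g := fun g hg => by
    obtain ⟨w, hw, -⟩ := c.in_unique g
    exact hz w ((c.rel_iff _ _).2 ⟨g, hw, hg⟩)
  rcases z with α | x | y
  · exact absurd rfl (key _)
  · exact ⟨x, rfl⟩
  · exact absurd rfl (key _)

theorem exists_eq_tau {z : A.BlossomE} (hz : ∀ x, ¬ A.blossomRel hA z x) : ∃ y, z = .tau y := by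
  obtain ⟨c⟩ := nonempty_blossomSlots hA
  have key : ∀ g, c.inSlot z ≠ some g := fun g hg => by
    obtain ⟨w, hw, -⟩ := c.out_unique g
    exact hz w ((c.rel_iff _ _).2 ⟨g, hg, hw⟩)
  rcases z with α | x | y
  · exact absurd rfl (key _)
  · exact absurd rfl (key _)
  · exact ⟨y, rfl⟩

theorem exists_maxAntipath [Finite A.V] [Finite A.E] (y : A.SinkBlossom) :
    ∃ D : A.MaxAntipath hA, D.1.getLast? = some (.tau y) := by
  obtain ⟨c⟩ := nonempty_blossomSlots hA
  obtain ⟨z, h1, h2⟩ := exists_reflTransGen_terminal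
    (r := Function.swap (A.blossomRel hA)) (x := .tau y)
    (fun x y z hx hy => by
      obtain ⟨g, h1, h2⟩ := (c.rel_iff _ _).1 hx
      obtain ⟨h, h3, h4⟩ := (c.rel_iff _ _).1 hy
      obtain rfl := Option.some.inj (h1.symm.trans h3)
      exact c.outSlot_inj h2 h4)
    (fun z hz => not_rel_tau y z hz)
  obtain ⟨x, rfl⟩ := exists_eq_sig h2
  rw [Relation.reflTransGen_swap] at h1
  obtain ⟨w, hw, -, h3⟩ := (exists_isMaximalWord_iff (not_rel_sig x) (not_rel_tau y)).2 h1
  exact ⟨⟨w, hw⟩, h3⟩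

variable [Finite A.V] [Finite A.E]

/-- Along an antipath the slots are permuted by `next`; the last slot is the only terminal one. -/
theorem exists_iterate_next (w : List A.BlossomE) (x : A.BlossomE)
    (hw : (x :: w).IsChain (A.blossomRel hA)) {h : A.Slot} (hx : c.inSlot x = some h)
    {y : A.SinkBlossom} (hy : (x :: w).getLast? = some (.tau y)) :
    ∃ n, w.length = n + 1 ∧ c.next^[n] h = c.tau y ∧ ∀ j < n, c.next^[j] h ∉ c.terminal := by
  induction w generalizing x h with
  | nil =>
    obtain rfl : x = .tau y := by simpa using hy
    simp [BlossomE.slotIn] at hx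
  | cons z w ih =>
    rw [List.isChain_cons_cons] at hw
    rw [List.getLast?_cons_cons] at hy
    obtain ⟨g, h1, h2⟩ := (c.rel_iff _ _).1 hw.1
    obtain rfl := Option.some.inj (h1.symm.trans hx)
    rcases z with α | z | z
    · obtain rfl := Option.some.inj h2
      obtain ⟨n, h3, h4, h5⟩ := ih (.old α) hw.2 rfl hy
      refine ⟨n + 1, by rw [List.length_cons, h3], ?_, ?_⟩
      · rw [Function.iterate_succ_apply, c.next_out, h4]
      · rintro (_ | j) hj
        · exact c.out_notMem_terminal α
        · rw [Function.iterate_succ_apply, c.next_out]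
          exact h5 j (by omega)
    · simp [BlossomE.slotOut] at h2
    · obtain rfl := Option.some.inj h2
      cases w with
      | nil =>
        obtain rfl : z = y := by simpa using hy
        exact ⟨0, rfl, rfl, by simp⟩
      | cons z' w =>
        rw [List.isChain_cons_cons] at hw
        exact absurd hw.2.1 (not_rel_tau _ _)

/-- The maximal antipath `Δ_p` is the thread that begins at the slot entered by its first arrow and
ends at the slot left by its last arrow `τ_p`. -/
theorem exists_isThreading : ∃ first last : A.MaxAntipath hA → A.Slot,
    IsThreading c.next c.terminal first last (fun D => D.delta.length) (A.PhiStep hA) := by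
  have key : ∀ D : A.MaxAntipath hA, ∃ x y, D.1.head? = some (.sig x) ∧
      D.1.getLast? = some (.tau y) ∧ c.next^[D.delta.length] (c.sig x) = c.tau y ∧
      ∀ j < D.delta.length, c.next^[j] (c.sig x) ∉ c.terminal := by
    rintro ⟨w, hw⟩
    obtain ⟨a, b, ha, hb, hch, h1, h2⟩ := isMaximalWord_iff.1 hw
    obtain ⟨x, rfl⟩ := exists_eq_sig (hA := hA) h1
    obtain ⟨y, rfl⟩ := exists_eq_tau (hA := hA) h2
    refine ⟨x, y, ha, hb, ?_⟩
    cases w with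
    | nil => simp at ha
    | cons z w =>
      obtain rfl : z = .sig x := by simpa using ha
      obtain ⟨n, h3, h4, h5⟩ := c.exists_iterate_next w _ hch rfl hb
      have h6 : MaxAntipath.delta (⟨_, hw⟩ : A.MaxAntipath hA) = w.dropLast := rfl
      rw [h6, List.length_dropLast, h3, Nat.add_sub_cancel]
      exact ⟨h4, h5⟩
  choose x y hx hy hit hnot using key
  refine ⟨fun D => c.sig (x D), fun D => c.tau (y D), ?_, ?_, hit, hnot, ?_, ?_⟩
  · intro D D' h
    have h1 : D.1.getLast? = D'.1.getLast? := by rw [hy, hy, c.tau_injective h]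
    refine Subtype.ext (List.reverse_injective (IsMaximalWord.eq_of_head ?_ D.2.reverse D'.2.reverse
      (by rw [List.head?_reverse, List.head?_reverse, h1])))
    intro z z' z'' h2 h3
    obtain ⟨g, h4, h5⟩ := (c.rel_iff _ _).1 h2
    obtain ⟨h, h6, h7⟩ := (c.rel_iff _ _).1 h3
    obtain rfl := Option.some.inj (h5.symm.trans h7)
    exact c.inSlot_inj h4 h6
  · ext h
    constructor
    · rintro ⟨D, rfl⟩
      exact ⟨_, rfl⟩
    · rintro ⟨y', rfl⟩
      obtain ⟨D, hD⟩ := exists_maxAntipath (hA := hA) y'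
      refine ⟨D, congrArg c.tau ?_⟩
      rw [hy] at hD
      simpa using hD
  · intro D
    obtain ⟨p, hp⟩ := exists_label_src (hA := hA) (x D)
    exact ⟨c.tau p.snk, ⟨_, rfl⟩, by rw [c.next_tau, hp]⟩
  · intro D D'
    constructor
    · rintro ⟨p, h1, h2⟩
      rw [hx] at h1
      rw [hy] at h2
      have h3 : x D = p.src := by simpa using h1
      have h4 : y D' = p.snk := by simpa using h2
      simp only [h3, h4, c.next_tau]
    · intro h
      obtain ⟨p, hp⟩ := exists_label_snk (hA := hA) (y D')
      simp only [← hp, c.next_tau] at h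
      exact ⟨p, by rw [hx, c.sig_injective h], by rw [hy, hp]⟩

/-- The invariant `φ_A(q, l)` counts the cycles of the permutation of the slots that consist of
`q + l` slots, `q` of which are terminal. -/
theorem mul_phi {q : ℕ} (hq : 0 < q) (l : ℕ) :
    q * A.phi hA q l = {h | h ∈ c.terminal ∧ cycleVisits c.next c.terminal h = q ∧
      Function.minimalPeriod c.next h = q + l}.ncard := by
  obtain ⟨first, last, ht⟩ := c.exists_isThreading
  rw [← ht.mul_ncard_orbits c.next_injective, phi, if_neg hq.ne']
  rfl

end BlossomSlots

/-! ### Slots of the repetitions -/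

instance [Finite A.V] : Finite (A.Label hA) :=
  Finite.of_injective Label.src fun _ _ => Label.ext_src

instance [Finite A.V] [Finite A.E] {k : ℕ} : Finite (RepE A (A.Label hA) k) := by
  refine Finite.of_surjective (fun x : A.E × Fin k ⊕ A.Label hA × Fin (k - 1) =>
    x.elim (fun y => .copy y.1 y.2) (fun y => .weld y.1 y.2)) ?_
  rintro (⟨α, i⟩ | ⟨p, i⟩)
  · exact ⟨.inl (α, i), rfl⟩
  · exact ⟨.inr (p, i), rfl⟩

/-- The slots of `A^(k)` are the copies of the slots of `A` on the `k` sheets. -/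
def sheetEquiv (A : BoundQuiver.{u}) (hA : A.IsLocallyGentle) (k : ℕ) :
    A.Slot × Fin k ≃ (A.repetition hA k).Slot where
  toFun x := ((x.1.1, x.2), x.1.2)
  invFun y := ((y.1.1, y.2), y.1.2)
  left_inv _ := rfl
  right_inv _ := rfl

namespace BlossomSlots

variable (c : A.BlossomSlots hA) {k : ℕ}

theorem mem_terminal_iff {h : A.Slot} : h ∈ c.terminal ↔ ∀ α, c.out α ≠ h := by
  constructor
  · rintro ⟨y, rfl⟩ α
    exact c.out_ne_tau α y
  · intro h1
    rcases c.out_or_tau h with ⟨α, h2⟩ | h2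
    · exact absurd h2 (h1 α)
    · exact h2

/-- The slot of `A` below the slot which an arrow of `A^(k)` enters. -/
def repIn : RepE A (A.Label hA) k → A.Slot
  | .copy α _ => c.inn α
  | .weld p _ => c.sig p.src

/-- The slot of `A` below the slot which an arrow of `A^(k)` leaves. -/
def repOut : RepE A (A.Label hA) k → A.Slot
  | .copy α _ => c.out α
  | .weld p _ => c.tau p.snk

theorem inSlot_inArrow (x : RepE A (A.Label hA) k) : c.inSlot x.inArrow = some (c.repIn x) := by
  cases x <;> rfl

theorem outSlot_outArrow (x : RepE A (A.Label hA) k) :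
    c.outSlot x.outArrow = some (c.repOut x) := by
  cases x <;> rfl

/-- The slots of the arrows of `A^(k)`, induced by those of the arrows of the blossoming of `A`. -/
def repetitionSlots (k : ℕ) : (A.repetition hA k).Slots where
  inn x := sheetEquiv A hA k (c.repIn x, x.targetSheet)
  out x := sheetEquiv A hA k (c.repOut x, x.sourceSheet)
  inn_fst x := by
    refine Prod.ext ?_ rfl
    cases x
    · exact c.inn_fst _
    · exact c.sig_fst _
  out_fst x := by
    refine Prod.ext ?_ rfl
    cases x
    · exact c.out_fst _
    · exact c.tau_fst _
  inn_inj x y h := by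
    obtain ⟨h1, h2⟩ := Prod.mk.inj ((sheetEquiv A hA k).injective h)
    exact RepE.ext_in (c.inSlot_inj (c.inSlot_inArrow x) (h1 ▸ c.inSlot_inArrow y)) h2
  out_inj x y h := by
    obtain ⟨h1, h2⟩ := Prod.mk.inj ((sheetEquiv A hA k).injective h)
    exact RepE.ext_out (c.outSlot_inj (c.outSlot_outArrow x) (h1 ▸ c.outSlot_outArrow y)) h2
  rel_iff x y := by
    change x.targetSheet = y.sourceSheet ∧ A.blossomRel hA x.inArrow y.outArrow ↔ _
    rw [(sheetEquiv A hA k).apply_eq_iff_eq, Prod.mk.injEq, and_comm,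
      c.rel_iff]
    refine and_congr_left fun _ => ⟨?_, fun h => ⟨_, c.inSlot_inArrow x, ?_⟩⟩
    · rintro ⟨h, h1, h2⟩
      exact (Option.some.inj ((c.inSlot_inArrow x).symm.trans h1)).trans
        (Option.some.inj (h2.symm.trans (c.outSlot_outArrow y)))
    · rw [h]
      exact c.outSlot_outArrow y

/-- A maximal path of the blossoming of `A` from `σ_p` to `τ_p` is repeated on all sheets of
`A^(k)`: its copies are joined by the connecting arrows to a path from the first sheet to the last
one. -/
theorem reflTransGen_pathStep_repetition
    (d : (A.repetition hA k).BlossomSlots (A.repetition_isLocallyGentle hA k))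
    (hin : d.inn = (c.repetitionSlots k).inn) (hout : d.out = (c.repetitionSlots k).out)
    (p : A.Label hA) (i : ℕ) (hi : i < k) :
    Relation.ReflTransGen d.PathStep (sheetEquiv A hA k (c.sig p.src, ⟨0, by omega⟩))
      (sheetEquiv A hA k (Slot.flip (c.tau p.snk), ⟨i, hi⟩)) := by
  have hsheet : ∀ j : Fin k, Relation.ReflTransGen d.PathStep (sheetEquiv A hA k (c.sig p.src, j))
      (sheetEquiv A hA k (Slot.flip (c.tau p.snk), j)) := by
    intro j
    refine (c.exists_label_iff.1 ⟨p, rfl, rfl⟩).lift (fun g => sheetEquiv A hA k (g, j)) ?_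
    rintro g _ ⟨α, h1, rfl⟩
    refine ⟨.copy α j, ?_, by rw [hin]; rfl⟩
    rw [hout]
    change sheetEquiv A hA k (c.out α, j) = _
    rw [h1]
    rfl
  induction i with
  | zero => exact hsheet _
  | succ i ih =>
    refine ((ih (by omega)).tail ?_).trans (hsheet ⟨i + 1, hi⟩)
    refine ⟨.weld p ⟨i, by omega⟩, ?_, by rw [hin]; rfl⟩
    rw [hout]
    change sheetEquiv A hA k (c.tau p.snk, ⟨i, _⟩) =
      sheetEquiv A hA k (Slot.flip (Slot.flip (c.tau p.snk)), ⟨i, _⟩)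
    rw [Slot.flip_flip]

variable [Finite A.V] [Finite A.E]

instance : Finite (A.repetition hA k).V := inferInstanceAs (Finite (A.V × Fin k))

instance : Finite (A.repetition hA k).E := inferInstanceAs (Finite (RepE A (A.Label hA) k))

/-- The permutation of the slots of `A^(k)` is a cyclic covering of that of `A`, for slots on the
blossoming of `A^(k)` that extend those of `repetitionSlots`. -/
theorem exists_isCyclicCover (k : ℕ) :
    ∃ d : (A.repetition hA k).BlossomSlots (A.repetition_isLocallyGentle hA k),
      IsCyclicCover c.next c.terminal (sheetEquiv A hA k) d.next d.terminal := by
  obtain ⟨d, hin, hout⟩ :=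
    (c.repetitionSlots k).exists_extension (A.repetition_isLocallyGentle hA k)
  have hmem : ∀ h i, sheetEquiv A hA k (h, i) ∈ d.terminal ↔ h ∈ c.terminal ∧ (i : ℕ) + 1 = k := by
    intro h i
    rw [d.mem_terminal_iff, hout]
    constructor
    · intro h1
      rcases c.out_or_tau h with ⟨α, rfl⟩ | ⟨y, rfl⟩
      · exact absurd rfl (h1 (.copy α i))
      · refine ⟨⟨y, rfl⟩, ?_⟩
        by_contra h2
        obtain ⟨p, rfl⟩ := exists_label_snk (hA := hA) y
        exact h1 (.weld p ⟨i, by omega⟩) rfl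
    · rintro ⟨⟨y, rfl⟩, hi⟩ x hx
      obtain ⟨h1, h2⟩ := Prod.mk.inj ((sheetEquiv A hA k).injective hx)
      rcases x with ⟨α, j⟩ | ⟨p, j⟩
      · exact c.out_ne_tau _ _ h1
      · have h3 : (j : ℕ) = i := congrArg Fin.val h2
        omega
  refine ⟨d, ⟨?_, ?_, hmem⟩⟩
  · rintro _ ⟨y, rfl⟩ i j hj
    obtain ⟨p, rfl⟩ := exists_label_snk (hA := hA) y
    rw [c.next_tau]
    rcases Nat.lt_or_ge (i + 1) k with hi | hi
    · rw [Nat.mod_eq_of_lt hi] at hj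
      have h1 : sheetEquiv A hA k (c.tau p.snk, i) = d.out (.weld p ⟨i, by omega⟩) := by
        rw [hout]; rfl
      rw [h1, d.next_out, hin]
      change sheetEquiv A hA k (c.sig p.src, _) = _
      congr 2
      exact Fin.ext hj.symm
    · have hi' : (i : ℕ) + 1 = k := by omega
      obtain ⟨y', hy'⟩ := (hmem (c.tau p.snk) i).2 ⟨⟨_, rfl⟩, hi'⟩
      rw [hi', Nat.mod_self] at hj
      -- The first sheet is entered by no connecting arrow.
      obtain ⟨x', hx'⟩ : ∃ x', d.sig x' = sheetEquiv A hA k (c.sig p.src, j) := by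
        rcases d.inn_or_sig (sheetEquiv A hA k (c.sig p.src, j)) with ⟨x, hx⟩ | hx
        · rw [hin] at hx
          obtain ⟨h1, h2⟩ := Prod.mk.inj ((sheetEquiv A hA k).injective hx)
          rcases x with ⟨α, m⟩ | ⟨p', m⟩
          · exact absurd h1 (c.inn_ne_sig _ _)
          · have h3 : (m : ℕ) + 1 = j := congrArg Fin.val h2
            omega
        · exact hx
      have h1 := c.reflTransGen_pathStep_repetition d hin hout p i i.2
      have h2 : (⟨0, by omega⟩ : Fin k) = j := Fin.ext hj.symm
      rw [h2, ← hx'] at h1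
      obtain ⟨p', rfl, rfl⟩ := d.exists_label_iff.2 (h1.trans (by
        change Relation.ReflTransGen _ (Slot.flip (sheetEquiv A hA k (c.tau p.snk, i))) _
        rw [← hy']))
      rw [← hy', ← hx', d.next_tau]
  · intro h hh i
    rcases c.out_or_tau h with ⟨α, rfl⟩ | hy
    · have h1 : sheetEquiv A hA k (c.out α, i) = d.out (.copy α i) := by rw [hout]; rfl
      rw [h1, d.next_out, hin, c.next_out]
      rfl
    · exact absurd hy hh

end BlossomSlots

end BoundQuiver

theorem mainTheorem2 (A : BoundQuiver.{u}) [Finite A.V] [Finite A.E] [Nonempty A.E]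
    (hconn : A.IsConnected) (hA : A.IsGentle) (q l : ℕ) (hq : 0 < q) :
    (A.phi hA.toIsLocallyGentle q l : ℚ) =
      1 / (q : ℚ) * ∑ c ∈ (Nat.gcd q l).divisors,
        (ArithmeticFunction.moebius c : ℚ) *
          ((A.repetition hA.toIsLocallyGentle (q / c)).phi
            (A.repetition_isLocallyGentle hA.toIsLocallyGentle (q / c))
            1 ((q + l) / c - 1) : ℚ) := by
  obtain ⟨b⟩ := BoundQuiver.nonempty_blossomSlots hA.toIsLocallyGentle
  have hq' : (q : ℚ) ≠ 0 := by exact_mod_cast hq.ne'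
  rw [one_div, eq_inv_mul_iff_mul_eq₀ hq', ← Nat.cast_mul, b.mul_phi hq]
  -- The cycles counted by `φ_A(q, l)` have `q + l` slots, and `gcd q (q + l) = gcd q l`.
  have h1 := ncard_eq_sum_moebius b.terminal (cycleVisits b.next b.terminal)
    (Function.minimalPeriod b.next) (n := q + l) hq
  rw [Nat.gcd_self_add_right] at h1
  rw [← Int.cast_natCast, h1, Int.cast_sum]
  refine Finset.sum_congr rfl fun c hc => ?_
  obtain ⟨hcq, hcl⟩ := Nat.dvd_gcd_iff.1 (Nat.mem_divisors.1 hc).1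
  have hk : 0 < q / c := Nat.div_pos (Nat.le_of_dvd hq hcq) (Nat.pos_of_dvd_of_pos hcq hq)
  have hn : 0 < (q + l) / c := hk.trans_le (Nat.div_le_div_right (Nat.le_add_right q l))
  obtain ⟨d, hd⟩ := b.exists_isCyclicCover (q / c)
  rw [Int.cast_mul, Int.cast_natCast, ← hd.ncard_eq hk b.next_injective hn,
    ← one_mul (BoundQuiver.phi _ _ _ _), d.mul_phi one_pos,
    Nat.add_sub_of_le (show 1 ≤ (q + l) / c from hn)]
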